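/- **Setting.** Let $n\ge 0$, $m\ge 1$, let $R:\mathbb R^n\to\mathbb R\cup\{+\infty\}$ be proper, convex and lower semi-continuous, and let $F=\frac1m\sum_{i=1}^m f_i$, where each $f_i:\mathbb R^n\to\mathbb R$ is convex and continuously differentiable with $L_i$-Lipschitz gradient. Put $L=\max_i L_i$ and $\Phi=R+F$, and assume that $\operatorname{Argmin}(\Phi)\neq\emptyset$. For $\gamma>0$ let $\operatorname{prox}_{\gamma R}(z)=\operatorname{argmin}_x\{\gamma R(x)+\frac12\|x-z\|^2\}$. Let $x_0\in\mathbb R^n$, and let all sampled indices below be independent and uniformly distributed on $\{1,\dots,m\}$. *SAGA* with step size $\gamma$: start with $g_i=\nabla f_i(x_0)$ for all $i$; for $k=0,1,2,\dots$ sample $i_k$, set $$x_{k+1}=\operatorname{prox}_{\gamma R}\Big(x_k-\gamma\big(\nabla f_{i_k}(x_k)-g_{i_k}+\tfrac1m\textstyle\sum_{i} g_i\big)\Big),$$ and then overwrite $g_{i_k}$ by $\nabla f_{i_k}(x_k)$. *Prox-SVRG (Option I)* with step size $\gamma$ and inner length $P\ge1$: start with $\tilde x_0=x_0$; for $\ell=0,1,2,\dots$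 put $x_{\ell,0}=\tilde x_\ell$, for $p=1,\dots,P$ sample $i_{\ell,p}$ and set $$x_{\ell,p}=\operatorname{prox}_{\gamma R}\Big(x_{\ell,p-1}-\gamma\big(\nabla f_{i_{\ell,p}}(x_{\ell,p-1})-\nabla f_{i_{\ell,p}}(\tilde x_\ell)+\tfrac1m\textstyle\sum_i\nabla f_i(\tilde x_\ell)\big)\Big),$$ and put $\tilde x_{\ell+1}=x_{\ell,P}$. Write $x_k=x_{\ell,p}$ for $k=\ell P+p$. *Partial smoothness.* $\partial R$ denotes the convex subdifferential. $R$ is partly smooth at $x$ relative to a set $M\ni x$ if $\partial R(x)\ne\emptyset$; $M$ is a $C^2$-submanifold of $\mathbb R^n$ around $x$ and $R|_M$ is (finite and) $C^2$ around $x$; the tangent space of $M$ at $x$ is the orthogonal complement of the linear subspace parallel to the affine hull of $\partial R(x)$; and the set-valued map $\partial R$ is continuous at $x$ relative to $M$, i.e. inner and outer semi-continuous in the sense of Painlevé–Kuratowski. **Statement.** Let $(x_k)$ be generated either 1. by SAGA with $\gamma=\frac1{3L}$, where $L>0$; or 2. by Prox-SVRG (Option I) with fixed $\gamma>0$ such that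 either $4L(P+2)\gamma\le1$, or $R$ and $F$ are strongly convex (with some moduli $\alpha_R,\alpha_F>0$) and $4L\gamma(P+1)<1$. Then in either case there is a random vector $x^\star$ such that, almost surely, $x^\star\in\operatorname{Argmin}(\Phi)$ and $x_k\to x^\star$. Moreover, almost surely the following holds: for every set $M\subseteq\mathbb R^n$ such that $R$ is partly smooth at $x^\star$ relative to $M$ and the non-degeneracy condition $-\nabla F(x^\star)\in\operatorname{ri}\partial R(x^\star)$ is satisfied, there is a finite (random) $K$ such that $x_k\in M$ for all $k\ge K$. -/

import Mathlib

open Filter Topology MeasureTheory ProbabilityTheory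
open scoped NNReal ENNReal

namespace ProxVR

noncomputable section

/-- The Euclidean space `ℝⁿ`. -/
abbrev Euc (n : ℕ) := EuclideanSpace ℝ (Fin n)

/-! ### Convex analysis for functions with values in `ℝ ∪ {+∞}` -/

/-- Convexity of an extended-real-valued function: its epigraph is convex. -/
def ConvexFun {n : ℕ} (R : Euc n → EReal) : Prop :=
  Convex ℝ {p : Euc n × ℝ | R p.1 ≤ (p.2 : EReal)}

/-- `R : ℝⁿ → ℝ ∪ {+∞}` is proper, convex and lower semi-continuous. -/
structure ProperConvexLsc {n : ℕ} (R : Euc n → EReal) : Prop where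
  ne_bot : ∀ x, R x ≠ ⊥
  proper : ∃ x, R x ≠ ⊤
  convex : ConvexFun R
  lsc : LowerSemicontinuous R

/-- `R` is `α`-strongly convex: `R - (α / 2) ‖·‖²` is convex. -/
def StronglyConvexFun {n : ℕ} (α : ℝ) (R : Euc n → EReal) : Prop :=
  ConvexFun fun x => R x - ((α / 2 * ‖x‖ ^ 2 : ℝ) : EReal)

/-- The convex subdifferential `∂R(x) = {g | R(y) ≥ R(x) + ⟪g, y - x⟫ for all y}`. -/
def subdiff {n : ℕ} (R : Euc n → EReal) (x : Euc n) : Set (Euc n) :=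
  {g | ∀ y, R x + ((inner ℝ g (y - x) : ℝ) : EReal) ≤ R y}

/-- The proximity operator `prox_{γR}(z) = argmin_x γ R(x) + ‖x - z‖² / 2`.  The minimiser exists
and is unique when `γ > 0` and `R` is proper, convex and lower semi-continuous. -/
def prox {n : ℕ} (γ : ℝ) (R : Euc n → EReal) (z : Euc n) : Euc n :=
  Classical.epsilon fun p =>
    ∀ x, (γ : EReal) * R p + ((‖p - z‖ ^ 2 / 2 : ℝ) : EReal) ≤
      (γ : EReal) * R x + ((‖x - z‖ ^ 2 / 2 : ℝ) : EReal)

/-! ### The composite problem -/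

/-- `F = (1 / m) ∑ i, f i`. -/
def avgFun {n m : ℕ} (f : Fin m → Euc n → ℝ) (x : Euc n) : ℝ :=
  (1 / (m : ℝ)) * ∑ i, f i x

/-- The average of `m` vectors. -/
def avgVec {n m : ℕ} (g : Fin m → Euc n) : Euc n :=
  (1 / (m : ℝ)) • ∑ i, g i

/-- The objective `Φ = R + F`. -/
def objective {n m : ℕ} (R : Euc n → EReal) (f : Fin m → Euc n → ℝ) (x : Euc n) : EReal :=
  R x + (avgFun f x : EReal)

/-- The set of global minimisers of `Φ`. -/
def argmin {n : ℕ} (Φ : Euc n → EReal) : Set (Euc n) :=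
  {x | ∀ y, Φ x ≤ Φ y}

/-! ### SAGA -/

/-- State of SAGA at the beginning of iteration `k` when the sampled indices are `s 0, s 1, …`:
the point `x_k` and the table of stored gradients.  The point is updated with the table as it was
before the entry `s k` is overwritten by `∇ f_{s k} (x_k)`. -/
def sagaState {n m : ℕ} (R : Euc n → EReal) (f : Fin m → Euc n → ℝ) (γ : ℝ) (x₀ : Euc n)
    (s : ℕ → Fin m) : ℕ → Euc n × (Fin m → Euc n)
  | 0 => (x₀, fun i => gradient (f i) x₀)
  | k + 1 =>
    let x := (sagaState R f γ x₀ s k).1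
    let g := (sagaState R f γ x₀ s k).2
    (prox γ R (x - γ • (gradient (f (s k)) x - g (s k) + avgVec g)),
      Function.update g (s k) (gradient (f (s k)) x))

/-- The SAGA iterate `x_k`. -/
def saga {n m : ℕ} (R : Euc n → EReal) (f : Fin m → Euc n → ℝ) (γ : ℝ) (x₀ : Euc n)
    (s : ℕ → Fin m) (k : ℕ) : Euc n :=
  (sagaState R f γ x₀ s k).1

/-! ### Prox-SVRG with Option I -/

/-- Inner loop with snapshot `xt` and sampled indices `t 0, t 1, …` (`t p` is used in the step from
the `p`-th to the `(p + 1)`-st inner iterate). -/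
def svrgInner {n m : ℕ} (R : Euc n → EReal) (f : Fin m → Euc n → ℝ) (γ : ℝ) (xt : Euc n)
    (t : ℕ → Fin m) : ℕ → Euc n
  | 0 => xt
  | p + 1 =>
    let x := svrgInner R f γ xt t p
    prox γ R (x - γ • (gradient (f (t p)) x - gradient (f (t p)) xt
      + avgVec fun i => gradient (f i) xt))

/-- Snapshots `x̃_ℓ` of the outer loop; Option I: the next snapshot is the last inner iterate. -/
def svrgOuter {n m : ℕ} (R : Euc n → EReal) (f : Fin m → Euc n → ℝ) (γ : ℝ) (P : ℕ) (x₀ : Euc n)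
    (s : ℕ → Fin m) : ℕ → Euc n
  | 0 => x₀
  | l + 1 => svrgInner R f γ (svrgOuter R f γ P x₀ s l) (fun p => s (l * P + p)) P

/-- The Prox-SVRG sequence `x_k = x_{ℓ, p}` for `k = ℓ P + p`. -/
def svrg {n m : ℕ} (R : Euc n → EReal) (f : Fin m → Euc n → ℝ) (γ : ℝ) (P : ℕ) (x₀ : Euc n)
    (s : ℕ → Fin m) (k : ℕ) : Euc n :=
  svrgInner R f γ (svrgOuter R f γ P x₀ s (k / P)) (fun p => s (k / P * P + p)) (k % P)

/-- `s 0, s 1, …` are independent and uniformly distributed on `{1, …, m}`. -/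
structure IIDUniform {Ω : Type*} [MeasurableSpace Ω] {m : ℕ} (s : ℕ → Ω → Fin m)
    (μ : Measure Ω) : Prop where
  measurable : ∀ k, Measurable (s k)
  indep : iIndepFun s μ
  uniform : ∀ k j, μ {ω | s k ω = j} = (m : ℝ≥0∞)⁻¹

/-! ### Partial smoothness -/

/-- `M` is a `C²`-submanifold of `ℝⁿ` around its point `x`, with tangent space `T` at `x`: near `x`
it is the zero set of a `C²` map `h` with surjective derivative at `x`, and `T = ker h'(x)`. -/
def IsC2ManifoldAround {n : ℕ} (M : Set (Euc n)) (x : Euc n) (T : Submodule ℝ (Euc n)) : Prop :=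
  x ∈ M ∧ ∃ (c : ℕ) (h : Euc n → Euc c), ContDiffAt ℝ 2 h x ∧
    Function.Surjective (fderiv ℝ h x) ∧
    (∀ᶠ y in 𝓝 x, y ∈ M ↔ h y = 0) ∧
    T = LinearMap.ker (fderiv ℝ h x).toLinearMap

/-- The restriction of `R` to `M` is finite and `C²` around `x`: near `x` it agrees on `M` with a
`C²` function. -/
def IsC2Along {n : ℕ} (R : Euc n → EReal) (M : Set (Euc n)) (x : Euc n) : Prop :=
  ∃ G : Euc n → ℝ, ContDiffAt ℝ 2 G x ∧ ∀ᶠ y in 𝓝 x, y ∈ M → R y = (G y : EReal)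

/-- Continuity (inner and outer semi-continuity, in the sense of Painlevé–Kuratowski) of a
set-valued mapping `S` at `x` relative to `M`. -/
def SetValuedContinuousAt {n : ℕ} (S : Euc n → Set (Euc n)) (M : Set (Euc n)) (x : Euc n) : Prop :=
  (∀ g ∈ S x, ∀ V ∈ 𝓝 g, ∀ᶠ y in 𝓝[M] x, (S y ∩ V).Nonempty) ∧
  (∀ g ∉ S x, ∃ V ∈ 𝓝 g, ∀ᶠ y in 𝓝[M] x, S y ∩ V = ∅)

/-- `R` is partly smooth at `x` relative to `M`.  The linear hull of a convex set is the subspace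
parallel to its affine hull, that is `vectorSpan`. -/
def PartlySmooth {n : ℕ} (R : Euc n → EReal) (x : Euc n) (M : Set (Euc n)) : Prop :=
  (subdiff R x).Nonempty ∧
  IsC2ManifoldAround M x (vectorSpan ℝ (subdiff R x))ᗮ ∧
  IsC2Along R M x ∧
  SetValuedContinuousAt (subdiff R) M x

/-- The non-degeneracy condition `-∇F(x) ∈ ri ∂R(x)`. -/
def NonDegenerate {n : ℕ} (R : Euc n → EReal) (F : Euc n → ℝ) (x : Euc n) : Prop :=
  -gradient F x ∈ intrinsicInterior ℝ (subdiff R x)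

end

end ProxVR

/-! Fix a minimiser `u`. One step of either method satisfies, on average over the fresh sample, `‖x⁺
- u‖² + residual ≤ ‖x - u‖² - (2γ/L - 2γ²) gap(x) + 2γ² gap(g)` (`mean_norm_proxStep_sub_sq_le`).
Here `gap` measures how far a table of component gradients is from the gradients at `u`, and
`residual` is what firm nonexpansiveness of the prox leaves over. The harmful term `2γ² gap(g)` is
absorbed by adding to `‖x - u‖²` a multiple `E` of `gap(g)`: a fixed multiple for SAGA, one that
shrinks along the inner loop for SVRG. The sum is a nonnegative supermartingale with decrement `U ≥
ε gap(x) + residual`.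

Supermartingale convergence (`ae_tendsto_of_average_decrease`) then gives, almost surely, `U → 0`,
hence `E → 0`, and convergence of `‖x_k - u‖`. Since `gap(x_k) → 0`, `∇F(x_k) → ∇F(u)`; since the
residual vanishes, the subgradients of `R` at `x_{k+1}` produced by the prox tend to `-∇F(u)`.
Closedness of the graph of `∂R` makes every cluster point a minimiser, and Opial's argument over a
countable dense set of minimisers gives convergence of the whole sequence
(`exists_ae_tendsto_of_lyapunov`).

Identification is then deterministic: iterates `x_k → x` carrying subgradients that converge to a
relative interior point of `∂R(x)` eventually lie in `M` (`PartlySmooth.eventually_mem`). If not,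
their normalised normal displacement from `M` would contradict monotonicity of `∂R`. -/

namespace ProxVR


/-! ### Supermartingale convergence for functions of the samples -/

section Sampling

variable {Ω : Type*} [mΩ : MeasurableSpace Ω] {μ : Measure Ω} {m : ℕ} {s : ℕ → Ω → Fin m}

/-- The filtration whose `k`-th σ-algebra is generated by the samples `s 0, …, s (k - 1)`. -/
def pastFiltration (s : ℕ → Ω → Fin m) (hs : ∀ k, Measurable (s k)) : Filtration ℕ mΩ where
  seq k := ⨆ i ∈ Set.Iio k, MeasurableSpace.comap (s i) inferInstance
  mono' _ _ hkl := iSup₂_le fun i hi =>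
    le_iSup₂_of_le i (lt_of_lt_of_le (Set.mem_Iio.1 hi) hkl) le_rfl
  le' _ := iSup₂_le fun i _ => (hs i).comap_le

theorem measurable_pastFiltration_of_dependsOn (hs : ∀ k, Measurable (s k)) {β : Type*}
    [MeasurableSpace β] [Nonempty β] {k : ℕ} {V : (ℕ → Fin m) → β}
    (hV : DependsOn V (Set.Iio k)) :
    Measurable[pastFiltration s hs k] fun ω => V fun j => s j ω := by
  obtain ⟨g, rfl⟩ := dependsOn_iff_exists_comp.1 hV
  have hg : Measurable g := Measurable.of_discrete
  refine hg.comp ?_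
  refine (@measurable_pi_iff _ _ _ (pastFiltration s hs k) _ _).2 fun i => ?_
  exact Measurable.of_comap_le (le_iSup₂_of_le (f := fun i (_ : i ∈ Set.Iio k) =>
    MeasurableSpace.comap (s i) inferInstance) i.1 i.2 le_rfl)

theorem exists_bound_of_dependsOn {k : ℕ} {V : (ℕ → Fin m) → ℝ}
    (hV : DependsOn V (Set.Iio k)) : ∃ C, ∀ t, ‖V t‖ ≤ C := by
  obtain ⟨g, rfl⟩ := dependsOn_iff_exists_comp.1 hV
  obtain ⟨C, hC⟩ := (Set.finite_range fun t => ‖g t‖).bddAbove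
  exact ⟨C, fun t => hC ⟨_, rfl⟩⟩

theorem integrable_of_dependsOn [IsFiniteMeasure μ] (hs : ∀ k, Measurable (s k)) {k : ℕ}
    {V : (ℕ → Fin m) → ℝ} (hV : DependsOn V (Set.Iio k)) :
    Integrable (fun ω => V fun j => s j ω) μ := by
  obtain ⟨C, hC⟩ := exists_bound_of_dependsOn hV
  refine Integrable.of_bound ?_ C (ae_of_all _ fun ω => hC _)
  exact ((measurable_pastFiltration_of_dependsOn hs hV).mono
    ((pastFiltration s hs).le k) le_rfl).aestronglyMeasurable

theorem dependsOn_update {β : Type*} {k : ℕ} {V : (ℕ → Fin m) → β}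
    (hV : DependsOn V (Set.Iio (k + 1))) (j : Fin m) :
    DependsOn (fun t => V (Function.update t k j)) (Set.Iio k) := by
  intro t t' h
  refine hV fun i hi => ?_
  rcases eq_or_ne i k with rfl | hik
  · simp
  · simpa [hik] using h i (lt_of_le_of_ne (Nat.lt_succ_iff.1 hi) hik)

/-- This is the conditional expectation given the first `k` samples, tested on past events. Split
according to the value `j` of `s k`: the indicator of `s k = j` has mean `1/m` and is independent of
everything determined by the past. -/
theorem setIntegral_succ_eq_average [IsProbabilityMeasure μ] (hs : IIDUniform s μ) {k : ℕ}
    {V : (ℕ → Fin m) → ℝ} (hV : DependsOn V (Set.Iio (k + 1))) {A : Set Ω}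
    (hA : MeasurableSet[pastFiltration s hs.measurable k] A) :
    ∫ ω in A, V (fun j => s j ω) ∂μ =
      ∫ ω in A, (1 / (m : ℝ)) * ∑ j, V (Function.update (fun i => s i ω) k j) ∂μ := by
  have hA' : MeasurableSet A := (pastFiltration s hs.measurable).le k _ hA
  let X : Fin m → Ω → ℝ := fun j ω => V (Function.update (fun i => s i ω) k j)
  let B : Fin m → Ω → ℝ := fun j => (s k ⁻¹' {j}).indicator 1
  have hX : ∀ j, Measurable[pastFiltration s hs.measurable k] (X j) := fun j =>
    measurable_pastFiltration_of_dependsOn hs.measurable (dependsOn_update hV j)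
  have hXi : ∀ j, Integrable (X j) μ := fun j =>
    integrable_of_dependsOn hs.measurable (dependsOn_update hV j)
  have hBmeas : ∀ j, MeasurableSet (s k ⁻¹' {j}) := fun j =>
    hs.measurable k (measurableSet_singleton j)
  have hsum : ∀ ω, V (fun j => s j ω) = ∑ j, B j ω * X j ω := by
    intro ω
    rw [Finset.sum_eq_single (s k ω)]
    · simp [B, X]
    · intro j _ hj
      simp [B, hj.symm]
    · simp
  have hB : ∀ j, ∫ ω, B j ω ∂μ = 1 / (m : ℝ) := by
    intro j
    simp only [B]
    rw [integral_indicator_one (hBmeas j), Measure.real,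
      show s k ⁻¹' {j} = {ω | s k ω = j} from rfl, hs.uniform k j]
    simp
  have hind : Indep (pastFiltration s hs.measurable k)
      (MeasurableSpace.comap (s k) inferInstance) μ := by
    have := indep_iSup_of_disjoint (fun i => (hs.measurable i).comap_le) hs.indep
      (S := Set.Iio k) (T := {k}) (by simp)
    simpa [pastFiltration] using this
  have key : ∀ j, ∫ ω in A, B j ω * X j ω ∂μ = 1 / (m : ℝ) * ∫ ω in A, X j ω ∂μ := by
    intro j
    have h1 : IndepFun (B j) (A.indicator (X j)) μ := by
      refine (indep_of_indep_of_le_left (indep_of_indep_of_le_right hind.symm ?_) ?_)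
      · exact (Measurable.indicator (hX j) hA).comap_le
      · have h2 : Measurable (({j} : Set (Fin m)).indicator (1 : Fin m → ℝ)) := Measurable.of_discrete
        exact (h2.comp (comap_measurable (s k))).comap_le
    rw [← integral_indicator hA', ← integral_indicator hA', ← hB j]
    have h2 := h1.integral_fun_mul_eq_mul_integral
      ((measurable_one.indicator (hBmeas j)).aestronglyMeasurable)
      (((hXi j).indicator hA').aestronglyMeasurable)
    rw [← h2]
    congr 1
    ext ω
    by_cases h : ω ∈ A <;> simp [h]
  have hBX : ∀ j, Integrable (fun ω => B j ω * X j ω) μ := by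
    intro j
    have : (fun ω => B j ω * X j ω) = (s k ⁻¹' {j}).indicator (X j) := by
      ext ω; by_cases h : ω ∈ s k ⁻¹' {j} <;> simp [B, h]
    rw [this]
    exact (hXi j).indicator (hBmeas j)
  simp_rw [hsum]
  rw [integral_finsetSum _ fun j _ => (hBX j).integrableOn, integral_const_mul,
    integral_finsetSum _ fun j _ => (hXi j).integrableOn, Finset.mul_sum]
  exact Finset.sum_congr rfl fun j _ => key j

/-- Doob's theorem: by nonnegativity the `L¹` norms equal the expectations, which never exceed the
initial one. -/
theorem ae_exists_tendsto_of_average_le [IsProbabilityMeasure μ] (hs : IIDUniform s μ)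
    {V : ℕ → (ℕ → Fin m) → ℝ} (hV : ∀ k, DependsOn (V k) (Set.Iio k)) (hV0 : ∀ k t, 0 ≤ V k t)
    (hdec : ∀ k t, (1 / (m : ℝ)) * ∑ j, V (k + 1) (Function.update t k j) ≤ V k t) :
    ∀ᵐ ω ∂μ, ∃ c, Tendsto (fun k => V k fun j => s j ω) atTop (𝓝 c) := by
  set W : ℕ → Ω → ℝ := fun k ω => V k fun j => s j ω
  have hint : ∀ k, Integrable (W k) μ := fun k => integrable_of_dependsOn hs.measurable (hV k)
  have hsup : Supermartingale W (pastFiltration s hs.measurable) μ := by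
    refine supermartingale_of_setIntegral_succ_le
      (fun k => (measurable_pastFiltration_of_dependsOn hs.measurable (hV k)).stronglyMeasurable)
      hint fun k A hA => ?_
    rw [setIntegral_succ_eq_average hs (hV (k + 1)) hA]
    refine integral_mono ?_ (hint k).integrableOn fun ω => hdec k _
    exact ((integrable_finsetSum _ fun j _ => integrable_of_dependsOn hs.measurable
      (dependsOn_update (hV (k + 1)) j)).const_mul _).integrableOn
  have hanti : ∀ k, ∫ ω, W k ω ∂μ ≤ ∫ ω, W 0 ω ∂μ := by
    intro k
    simpa using hsup.setIntegral_le (Nat.zero_le k) MeasurableSet.univ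
  have hbdd : ∀ k, eLpNorm ((-W) k) 1 μ ≤ ((∫ ω, W 0 ω ∂μ).toNNReal : ℝ≥0∞) := by
    intro k
    rw [Pi.neg_apply, eLpNorm_neg, eLpNorm_one_eq_lintegral_enorm,
      ← ofReal_integral_norm_eq_lintegral_enorm (hint k)]
    refine ENNReal.ofReal_le_ofReal ?_
    refine le_trans (le_of_eq (integral_congr_ae (ae_of_all _ fun ω => ?_))) (hanti k)
    exact Real.norm_of_nonneg (hV0 k _)
  filter_upwards [hsup.neg.ae_tendsto_limitProcess hbdd] with ω hω
  exact ⟨_, by simpa [W] using hω.neg⟩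

/-- A nonnegative Lyapunov function that decreases on average converges almost surely, and the
decrements tend to `0`. -/
theorem ae_tendsto_of_average_decrease [IsProbabilityMeasure μ] (hs : IIDUniform s μ) (hm : 0 < m)
    {V U : ℕ → (ℕ → Fin m) → ℝ} (hV : ∀ k, DependsOn (V k) (Set.Iio k))
    (hU : ∀ k, DependsOn (U k) (Set.Iio k)) (hV0 : ∀ k t, 0 ≤ V k t) (hU0 : ∀ k t, 0 ≤ U k t)
    (hdec : ∀ k t, (1 / (m : ℝ)) * ∑ j, V (k + 1) (Function.update t k j) ≤ V k t - U k t) :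
    ∀ᵐ ω ∂μ, (∃ c, Tendsto (fun k => V k fun j => s j ω) atTop (𝓝 c)) ∧
      Tendsto (fun k => U k fun j => s j ω) atTop (𝓝 0) := by
  have hm' : (m : ℝ) ≠ 0 := by positivity
  have h1 := ae_exists_tendsto_of_average_le hs hV hV0
    fun k t => (hdec k t).trans (by linarith [hU0 k t])
  have hdep : ∀ k, ∀ i < k, ∀ ⦃t t' : ℕ → Fin m⦄, (∀ i ∈ Set.Iio k, t i = t' i) →
      U i t = U i t' := fun k i hi t t' h =>
    hU i fun l hl => h l (lt_trans (Set.mem_Iio.1 hl) hi)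
  -- Adding the decrements accumulated so far preserves the supermartingale property. As `V` alone
  -- also converges, the partial sums of `U` converge, so `U → 0`.
  have h2 := ae_exists_tendsto_of_average_le hs
    (V := fun k t => V k t + ∑ i ∈ Finset.range k, U i t)
    (fun k t t' h => by
      simp only
      rw [hV k h, Finset.sum_congr rfl fun i hi => hdep k i (Finset.mem_range.1 hi) h])
    (fun k t => add_nonneg (hV0 k t) (Finset.sum_nonneg fun i _ => hU0 i t))
    (fun k t => by
      have : ∀ j, ∑ i ∈ Finset.range (k + 1), U i (Function.update t k j) =
          ∑ i ∈ Finset.range (k + 1), U i t := fun j =>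
        Finset.sum_congr rfl fun i hi => hU i fun l hl => by
          have : l ≠ k := by
            have := Finset.mem_range.1 hi
            have := Set.mem_Iio.1 hl
            omega
          simp [this]
      simp only [this, Finset.sum_add_distrib, mul_add, Finset.sum_const, Finset.card_univ,
        Fintype.card_fin, nsmul_eq_mul]
      rw [← mul_assoc, one_div_mul_cancel hm', one_mul, Finset.sum_range_succ]
      linarith [hdec k t])
  filter_upwards [h1, h2] with ω ⟨c, hc⟩ ⟨d, hd⟩
  refine ⟨⟨c, hc⟩, ?_⟩
  have h3 : Tendsto (fun k => ∑ i ∈ Finset.range k, U i fun j => s j ω) atTop (𝓝 (d - c)) := by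
    simpa using hd.sub hc
  have h4 := (h3.comp (tendsto_add_atTop_nat 1)).sub h3
  simpa [Finset.sum_range_succ] using h4

end Sampling


/-! ### Convex subdifferentials: monotonicity, Fermat's rule, closed graph -/

section Subdifferential

variable {n : ℕ} {R : Euc n → EReal}

theorem ProperConvexLsc.exists_real (hR : ProperConvexLsc R) {x : Euc n} (hx : R x ≠ ⊤) :
    ∃ r : ℝ, R x = r :=
  ⟨(R x).toReal, (EReal.coe_toReal hx (hR.ne_bot x)).symm⟩

theorem ProperConvexLsc.exists_real_of_mem_subdiff (hR : ProperConvexLsc R) {x g : Euc n}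
    (hg : g ∈ subdiff R x) : ∃ r : ℝ, R x = r := by
  refine hR.exists_real fun hx => ?_
  obtain ⟨y, hy⟩ := hR.proper
  have := hg y
  rw [hx, EReal.top_add_coe] at this
  exact hy (top_le_iff.1 this)

theorem ProperConvexLsc.mem_subdiff_iff (hR : ProperConvexLsc R) {x g : Euc n} {r : ℝ}
    (hx : R x = r) :
    g ∈ subdiff R x ↔ ∀ (y : Euc n) (ρ : ℝ), R y = ρ → r + inner ℝ g (y - x) ≤ ρ := by
  constructor
  · intro hg y ρ hy
    have := hg y
    rw [hx, hy] at this
    exact_mod_cast this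
  · intro h y
    by_cases hy : R y = ⊤
    · rw [hy]; exact le_top
    · obtain ⟨ρ, hρ⟩ := hR.exists_real hy
      rw [hx, hρ]
      exact_mod_cast h y ρ hρ

theorem ProperConvexLsc.subdiff_monotone (hR : ProperConvexLsc R) {x y g h : Euc n}
    (hg : g ∈ subdiff R x) (hh : h ∈ subdiff R y) : 0 ≤ inner ℝ (g - h) (x - y) := by
  obtain ⟨r, hr⟩ := hR.exists_real_of_mem_subdiff hg
  obtain ⟨ρ, hρ⟩ := hR.exists_real_of_mem_subdiff hh
  have h1 := (hR.mem_subdiff_iff hr).1 hg y ρ hρ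
  have h2 := (hR.mem_subdiff_iff hρ).1 hh x r hr
  have h3 : inner ℝ g (y - x) = - inner ℝ g (x - y) := by
    rw [← inner_neg_right, neg_sub]
  rw [inner_sub_left]
  linarith

theorem ConvexFun.le_combination (hR : ConvexFun R) {x y : Euc n} {r ρ : ℝ} (hx : R x = r)
    (hy : R y = ρ) {t : ℝ} (h0 : 0 ≤ t) (h1 : t ≤ 1) :
    R (x + t • (y - x)) ≤ ((r + t * (ρ - r) : ℝ) : EReal) := by
  have := hR (x := (x, r)) (y := (y, ρ)) (by simp [hx]) (by simp [hy]) (sub_nonneg.2 h1) h0 (by ring)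
  have h2 : (1 - t) • x + t • y = x + t • (y - x) := by module
  have h3 : (1 - t) * r + t * ρ = r + t * (ρ - r) := by ring
  simpa [h2, h3] using this

/-- Fermat's rule for the sum of a convex function and a differentiable one. -/
theorem ProperConvexLsc.neg_gradient_mem_subdiff (hR : ProperConvexLsc R) {F : Euc n → ℝ}
    {u d : Euc n} (hF : HasGradientAt F d u)
    (hmin : ∀ y, R u + (F u : EReal) ≤ R y + (F y : EReal)) : -d ∈ subdiff R u := by
  have hu : R u ≠ ⊤ := by
    intro hu
    obtain ⟨y, hy⟩ := hR.proper
    obtain ⟨ρ, hρ⟩ := hR.exists_real hy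
    have := hmin y
    rw [hu, hρ, EReal.top_add_coe, ← EReal.coe_add] at this
    exact EReal.coe_ne_top _ (top_le_iff.1 this)
  obtain ⟨r, hr⟩ := hR.exists_real hu
  refine (hR.mem_subdiff_iff hr).2 fun y ρ hρ => ?_
  have hder : HasDerivAt (fun t : ℝ => F (u + t • (y - u))) (inner ℝ d (y - u)) 0 := by
    have h1 : HasDerivAt (fun t : ℝ => u + t • (y - u)) (y - u) 0 := by
      simpa using ((hasDerivAt_id (0 : ℝ)).smul_const (y - u)).const_add u
    have h2 : HasFDerivAt F (InnerProductSpace.toDual ℝ (Euc n) d) (u + (0 : ℝ) • (y - u)) := by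
      simpa using hF.hasFDerivAt
    exact (h2.comp_hasDerivAt (0 : ℝ) h1).congr_deriv (by simp)
  have hlim := hder.tendsto_slope_zero_right
  -- Along the segment from `u` to `y`, minimality and convexity of `R` bound the difference
  -- quotients of `F` below by `r - ρ`; let `t ↓ 0`.
  have hge : r - ρ ≤ inner ℝ d (y - u) := by
    refine ge_of_tendsto hlim ?_
    filter_upwards [Ioc_mem_nhdsGT (zero_lt_one (α := ℝ))] with t ht
    have h1 := (hmin (u + t • (y - u))).trans
      (add_le_add_left (hR.convex.le_combination hr hρ ht.1.le ht.2) _)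
    rw [hr] at h1
    have h2 : r + F u ≤ r + t * (ρ - r) + F (u + t • (y - u)) := by exact_mod_cast h1
    simp only [zero_add, zero_smul, add_zero, smul_eq_mul]
    rw [inv_mul_eq_div, le_div_iff₀ ht.1]
    linarith
  rw [inner_neg_left]
  linarith

/-- The subgradient inequality passes to the limit because lower semi-continuity controls `R` at the
limit point; a single point of the domain already forces `R x` to be finite. -/
theorem ProperConvexLsc.mem_subdiff_of_tendsto (hR : ProperConvexLsc R) {x g : Euc n}
    {ι : Type*} {l : Filter ι} [l.NeBot] {xs gs : ι → Euc n} (hx : Tendsto xs l (𝓝 x))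
    (hg : Tendsto gs l (𝓝 g)) (h : ∀ᶠ k in l, gs k ∈ subdiff R (xs k)) : g ∈ subdiff R x := by
  have key : ∀ (y : Euc n) (ρ : ℝ), R y = ρ → R x ≤ ((ρ - inner ℝ g (y - x) : ℝ) : EReal) := by
    intro y ρ hρ
    have hlim : Tendsto (fun k => ((ρ - inner ℝ (gs k) (y - xs k) : ℝ) : EReal)) l
        (𝓝 ((ρ - inner ℝ g (y - x) : ℝ) : EReal)) :=
      (continuous_coe_real_ereal.tendsto _).comp
        (tendsto_const_nhds.sub (hg.inner (tendsto_const_nhds.sub hx)))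
    refine le_of_forall_lt fun c hc => ?_
    have hle : ∀ᶠ k in l, R (xs k) ≤ ((ρ - inner ℝ (gs k) (y - xs k) : ℝ) : EReal) := by
      filter_upwards [h] with k hk
      obtain ⟨r, hr⟩ := hR.exists_real_of_mem_subdiff hk
      have := (hR.mem_subdiff_iff hr).1 hk y ρ hρ
      rw [hr]
      exact_mod_cast (by linarith : r ≤ ρ - inner ℝ (gs k) (y - xs k))
    obtain ⟨c', hc', hc''⟩ := exists_between hc
    refine lt_of_lt_of_le hc' (ge_of_tendsto hlim ?_)
    filter_upwards [hle, hx.eventually (hR.lsc x c' hc'')] with k h1 h2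
    exact h2.le.trans h1
  obtain ⟨y, hy⟩ := hR.proper
  obtain ⟨ρ, hρ⟩ := hR.exists_real hy
  obtain ⟨r, hr⟩ := hR.exists_real (ne_top_of_le_ne_top (EReal.coe_ne_top _) (key y ρ hρ))
  refine (hR.mem_subdiff_iff hr).2 fun y ρ hρ => ?_
  have := key y ρ hρ
  rw [hr] at this
  have h' : r ≤ ρ - inner ℝ g (y - x) := by exact_mod_cast this
  linarith

end Subdifferential

/-! ### The proximity operator -/

section Prox

variable {n : ℕ} {R : Euc n → EReal}

/-- Moves the factor `γ` from `R` to the quadratic term, the form in which Fermat's rule for `R`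
plus a smooth function applies. -/
theorem coe_mul_add_le_iff {γ : ℝ} (hγ : 0 < γ) {A B : EReal} (hA : A ≠ ⊥) (hB : B ≠ ⊥) (a b : ℝ) :
    (γ : EReal) * A + (a : EReal) ≤ γ * B + b ↔
      A + ((a / γ : ℝ) : EReal) ≤ B + ((b / γ : ℝ) : EReal) := by
  induction A with
  | bot => exact absurd rfl hA
  | top =>
    induction B with
    | bot => exact absurd rfl hB
    | top => simp [EReal.coe_mul_top_of_pos hγ]
    | coe B =>
      rw [EReal.coe_mul_top_of_pos hγ, EReal.top_add_coe, EReal.top_add_coe]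
      rw [← EReal.coe_mul, ← EReal.coe_add, ← EReal.coe_add]
      simp only [top_le_iff, EReal.coe_ne_top]
  | coe A =>
    induction B with
    | bot => exact absurd rfl hB
    | top => simp [EReal.coe_mul_top_of_pos hγ]
    | coe B =>
      norm_cast
      rw [show A + a / γ = (γ * A + a) / γ by field_simp,
        show B + b / γ = (γ * B + b) / γ by field_simp, div_le_div_iff_of_pos_right hγ]

theorem ProperConvexLsc.exists_prox (hR : ProperConvexLsc R) {u g : Euc n} (hg : g ∈ subdiff R u)
    {γ : ℝ} (hγ : 0 < γ) (z : Euc n) :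
    ∃ p, ∀ x, (γ : EReal) * R p + ((‖p - z‖ ^ 2 / 2 : ℝ) : EReal) ≤
      (γ : EReal) * R x + ((‖x - z‖ ^ 2 / 2 : ℝ) : EReal) := by
  simp only [coe_mul_add_le_iff hγ (hR.ne_bot _) (hR.ne_bot _)]
  obtain ⟨r, hr⟩ := hR.exists_real_of_mem_subdiff hg
  set ψ : Euc n → EReal := fun x => R x + ((‖x - z‖ ^ 2 / 2 / γ : ℝ) : EReal)
  have hψ : LowerSemicontinuous ψ := by
    refine hR.lsc.add' (Continuous.lowerSemicontinuous ?_) fun x => ?_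
    · exact continuous_coe_real_ereal.comp (by fun_prop)
    · exact EReal.continuousAt_add (Or.inr (EReal.coe_ne_bot _)) (Or.inl (hR.ne_bot x))
  -- Outside this ball the quadratic growth outweighs the affine minorant of `R` given by `g`, so
  -- the objective is at least its value at `u`, and a minimiser over the compact ball is global.
  set ρ := ‖u - z‖ + 2 * γ * ‖g‖
  have hu : u ∈ Metric.closedBall z ρ := by
    rw [mem_closedBall_iff_norm]
    have : 0 ≤ 2 * γ * ‖g‖ := by positivity
    linarith
  obtain ⟨p, hp, hpmin⟩ := (hψ.lowerSemicontinuousOn _).exists_isMinOn ⟨u, hu⟩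
    (isCompact_closedBall z ρ)
  refine ⟨p, fun x => ?_⟩
  by_cases hx : x ∈ Metric.closedBall z ρ
  · exact hpmin hx
  refine (hpmin hu : ψ p ≤ ψ u).trans ?_
  by_cases hxt : R x = ⊤
  · simp [hxt]
  obtain ⟨q, hq⟩ := hR.exists_real hxt
  simp only [ψ, hr, hq]
  have h1 := (hR.mem_subdiff_iff hr).1 hg x q hq
  have h2 : -(‖g‖ * (‖x - z‖ + ‖u - z‖)) ≤ inner ℝ g (x - u) := by
    have h3 : ‖x - u‖ ≤ ‖x - z‖ + ‖u - z‖ := by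
      rw [← norm_neg (u - z), neg_sub]
      simpa using norm_add_le (x - z) (z - u)
    have h4 := (abs_le.1 (abs_real_inner_le_norm g (x - u))).1
    have h5 := mul_le_mul_of_nonneg_left h3 (norm_nonneg g)
    linarith
  rw [mem_closedBall_iff_norm, not_le] at hx
  have h6 : r + ‖u - z‖ ^ 2 / 2 / γ ≤ q + ‖x - z‖ ^ 2 / 2 / γ := by
    have h7 : ‖g‖ * (‖x - z‖ + ‖u - z‖) ≤ ‖x - z‖ ^ 2 / 2 / γ - ‖u - z‖ ^ 2 / 2 / γ := by
      rw [← sub_div, le_div_iff₀ hγ]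
      have h8 : 0 ≤ (‖x - z‖ + ‖u - z‖) * (‖x - z‖ - ‖u - z‖ - 2 * γ * ‖g‖) :=
        mul_nonneg (by positivity) (by simp only [ρ] at hx; linarith)
      nlinarith
    linarith
  exact_mod_cast h6

theorem ProperConvexLsc.prox_mem_subdiff (hR : ProperConvexLsc R) {u g : Euc n}
    (hg : g ∈ subdiff R u) {γ : ℝ} (hγ : 0 < γ) (z : Euc n) :
    (1 / γ) • (z - prox γ R z) ∈ subdiff R (prox γ R z) := by
  have hp := Classical.epsilon_spec (hR.exists_prox hg hγ z)
  change ∀ x, (γ : EReal) * R (prox γ R z) + ((‖prox γ R z - z‖ ^ 2 / 2 : ℝ) : EReal) ≤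
    (γ : EReal) * R x + ((‖x - z‖ ^ 2 / 2 : ℝ) : EReal) at hp
  simp only [coe_mul_add_le_iff hγ (hR.ne_bot _) (hR.ne_bot _)] at hp
  set p := prox γ R z
  have hgrad : HasGradientAt (fun x : Euc n => ‖x - z‖ ^ 2 / 2 / γ) ((1 / γ) • (p - z)) p := by
    rw [hasGradientAt_iff_hasFDerivAt]
    have h1 := (((hasFDerivAt_id (𝕜 := ℝ) p).sub_const z).norm_sq).mul_const (1 / (2 * γ))
    have h2 : (fun x : Euc n => ‖x - z‖ ^ 2 / 2 / γ) =
        fun x => ‖id x - z‖ ^ 2 * (1 / (2 * γ)) := by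
      ext x; simp only [id]; field_simp
    rw [h2]
    refine h1.congr_fderiv ?_
    ext v
    simp
    field_simp
  have := hR.neg_gradient_mem_subdiff hgrad hp
  rwa [← smul_neg, neg_sub] at this

/-- Firm nonexpansiveness at the points `z` and `u + γ g`, the latter having prox `u`. Expanding the
square on the right, the cross term is nonnegative by monotonicity. The second square on the left is
kept, since it later yields convergence of the subgradients. -/
theorem ProperConvexLsc.norm_prox_sub_sq_add_le (hR : ProperConvexLsc R) {u g : Euc n}
    (hg : g ∈ subdiff R u) {γ : ℝ} (hγ : 0 < γ) (z : Euc n) :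
    ‖prox γ R z - u‖ ^ 2 + ‖z - prox γ R z - γ • g‖ ^ 2 ≤ ‖z - u - γ • g‖ ^ 2 := by
  have h1 := hR.subdiff_monotone (hR.prox_mem_subdiff hg hγ z) hg
  set p := prox γ R z
  have h2 : z - u - γ • g = (p - u) + (z - p - γ • g) := by abel
  have h3 : (1 / γ) • (z - p) - g = (1 / γ) • (z - p - γ • g) := by
    rw [smul_sub (1 / γ) (z - p), smul_smul, one_div_mul_cancel hγ.ne', one_smul]
  rw [h3, inner_smul_left, real_inner_comm] at h1
  have h4 : 0 ≤ inner ℝ (p - u) (z - p - γ • g) := by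
    have : (0 : ℝ) < 1 / γ := by positivity
    exact nonneg_of_mul_nonneg_right (by simpa using h1) this
  rw [h2, norm_add_sq_real]
  linarith

end Prox

/-! ### Convex functions with Lipschitz gradient -/

section Smooth

variable {n : ℕ} {f : Euc n → ℝ}

theorem hasDerivAt_comp_line {x d : Euc n} (hf : Differentiable ℝ f) (t : ℝ) :
    HasDerivAt (fun t : ℝ => f (x + t • d)) (inner ℝ (gradient f (x + t • d)) d) t := by
  have h1 : HasDerivAt (fun t : ℝ => x + t • d) d t := by
    simpa using ((hasDerivAt_id t).smul_const d).const_add x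
  exact ((hf (x + t • d)).hasGradientAt.hasFDerivAt.comp_hasDerivAt t h1).congr_deriv (by simp)

theorem ConvexOn.add_inner_gradient_le (hf : ConvexOn ℝ Set.univ f) (hd : Differentiable ℝ f)
    (x y : Euc n) : f x + inner ℝ (gradient f x) (y - x) ≤ f y := by
  have hlim := (hasDerivAt_comp_line (x := x) (d := y - x) hd 0).tendsto_slope_zero_right
  have hle : inner ℝ (gradient f x) (y - x) ≤ f y - f x := by
    simp only [zero_add, zero_smul, add_zero, smul_eq_mul] at hlim
    refine le_of_tendsto hlim ?_
    filter_upwards [Ioc_mem_nhdsGT (zero_lt_one (α := ℝ))] with t ht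
    rw [inv_mul_eq_div, div_le_iff₀ ht.1]
    have h1 := hf.2 (Set.mem_univ x) (Set.mem_univ y) (sub_nonneg.2 ht.2) ht.1.le (by ring)
    rw [show (1 - t) • x + t • y = x + t • (y - x) by module] at h1
    simp only [smul_eq_mul] at h1
    linarith
  linarith

/-- The descent lemma. -/
theorem le_add_inner_gradient_add {L : ℝ} (hd : Differentiable ℝ f)
    (hL : ∀ x y, ‖gradient f x - gradient f y‖ ≤ L * ‖x - y‖) (x d : Euc n) :
    f (x + d) ≤ f x + inner ℝ (gradient f x) d + L / 2 * ‖d‖ ^ 2 := by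
  set φ : ℝ → ℝ := fun t => f (x + t • d) - (t * inner ℝ (gradient f x) d + t ^ 2 * (L / 2 * ‖d‖ ^ 2))
  have hφ : ∀ t, HasDerivAt φ (inner ℝ (gradient f (x + t • d)) d -
      (inner ℝ (gradient f x) d + 2 * t * (L / 2 * ‖d‖ ^ 2))) t := by
    intro t
    refine (hasDerivAt_comp_line hd t).sub (HasDerivAt.add ?_ ?_)
    · simpa using (hasDerivAt_id t).mul_const (inner ℝ (gradient f x) d)
    · simpa using (hasDerivAt_pow 2 t).mul_const (L / 2 * ‖d‖ ^ 2)
  have hanti : AntitoneOn φ (Set.Icc 0 1) := by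
    refine antitoneOn_of_deriv_nonpos (convex_Icc 0 1)
      (fun t _ => (hφ t).continuousAt.continuousWithinAt)
      (fun t _ => (hφ t).differentiableAt.differentiableWithinAt) fun t ht => ?_
    rw [interior_Icc] at ht
    rw [(hφ t).deriv]
    have h1 := real_inner_le_norm (gradient f (x + t • d) - gradient f x) d
    have h2 := hL (x + t • d) x
    rw [add_sub_cancel_left, norm_smul, Real.norm_of_nonneg ht.1.le] at h2
    rw [inner_sub_left] at h1
    have h3 := mul_le_mul_of_nonneg_right h2 (norm_nonneg d)
    nlinarith
  have := hanti (by simp) (by simp) (zero_le_one (α := ℝ))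
  simp only [φ, zero_smul, one_smul, add_zero] at this
  linarith

/-- The Baillon–Haddad inequality: the gradient of a convex `L`-smooth function is cocoercive. -/
theorem norm_gradient_sub_sq_le {L : ℝ} (hL0 : 0 < L) (hf : ConvexOn ℝ Set.univ f)
    (hd : Differentiable ℝ f) (hL : ∀ x y, ‖gradient f x - gradient f y‖ ≤ L * ‖x - y‖)
    (x y : Euc n) :
    1 / L * ‖gradient f x - gradient f y‖ ^ 2 ≤ inner ℝ (gradient f x - gradient f y) (x - y) := by
  have key : ∀ x y : Euc n, f x + inner ℝ (gradient f x) (y - x) +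
      1 / (2 * L) * ‖gradient f x - gradient f y‖ ^ 2 ≤ f y := by
    intro x y
    set e := gradient f x - gradient f y
    -- Compare at `y + e / L` the tangent minorant at `x` with the quadratic majorant at `y`; the
    -- step `1 / L` optimises the resulting bound. Adding the inequality to its copy with `x`, `y`
    -- exchanged gives cocoercivity.
    have h1 := ConvexOn.add_inner_gradient_le hf hd x (y + (1 / L) • e)
    have h2 := le_add_inner_gradient_add hd hL y ((1 / L) • e)
    have h3 : inner ℝ (gradient f x) (y + (1 / L) • e - x) =
        inner ℝ (gradient f x) (y - x) + 1 / L * inner ℝ (gradient f x) e := by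
      rw [show y + (1 / L) • e - x = (y - x) + (1 / L) • e by abel, inner_add_right,
        inner_smul_right]
    have h4 : inner ℝ (gradient f x) e - inner ℝ (gradient f y) e = ‖e‖ ^ 2 := by
      rw [← inner_sub_left, real_inner_self_eq_norm_sq]
    rw [h3] at h1
    rw [inner_smul_right, norm_smul, Real.norm_of_nonneg (by positivity)] at h2
    have h5 : L / 2 * (1 / L * ‖e‖) ^ 2 = 1 / (2 * L) * ‖e‖ ^ 2 := by field_simp
    have h6 : 1 / L * ‖e‖ ^ 2 = 1 / (2 * L) * ‖e‖ ^ 2 + 1 / (2 * L) * ‖e‖ ^ 2 := by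
      field_simp; ring
    have h7 : 1 / L * inner ℝ (gradient f x) e - 1 / L * inner ℝ (gradient f y) e =
        1 / L * ‖e‖ ^ 2 := by rw [← h4]; ring
    linarith
  have h1 := key x y
  have h2 := key y x
  rw [norm_sub_rev (gradient f y)] at h2
  have h3 : inner ℝ (gradient f x) (y - x) = - inner ℝ (gradient f x) (x - y) := by
    rw [← inner_neg_right, neg_sub]
  have h4 : 1 / L * ‖gradient f x - gradient f y‖ ^ 2 =
      2 * (1 / (2 * L) * ‖gradient f x - gradient f y‖ ^ 2) := by field_simp
  rw [inner_sub_left, h4]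
  linarith

end Smooth

/-! ### The averaged function and the optimality condition -/

section Composite

variable {n m : ℕ} {f : Fin m → Euc n → ℝ}

theorem differentiable_avgFun (hd : ∀ i, Differentiable ℝ (f i)) :
    Differentiable ℝ (avgFun f) := by
  unfold avgFun
  fun_prop

theorem gradient_avgFun (hd : ∀ i, Differentiable ℝ (f i)) (x : Euc n) :
    gradient (avgFun f) x = avgVec fun i => gradient (f i) x := by
  refine HasGradientAt.gradient ?_
  rw [hasGradientAt_iff_hasFDerivAt, avgVec, map_smul, map_sum]
  simp only [toDual_gradient]
  exact (HasFDerivAt.fun_sum fun i _ => (hd i x).hasFDerivAt).const_mul (1 / (m : ℝ))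

theorem convexOn_avgFun (hf : ∀ i, ConvexOn ℝ Set.univ (f i)) :
    ConvexOn ℝ Set.univ (avgFun f) := by
  refine ⟨convex_univ, fun x hx y hy a b ha hb hab => ?_⟩
  simp only [avgFun, smul_eq_mul]
  rw [mul_left_comm, mul_left_comm b, ← mul_add, Finset.mul_sum (a := a), Finset.mul_sum (a := b),
    ← Finset.sum_add_distrib]
  gcongr with i
  exact (hf i).2 hx hy ha hb hab

theorem ProperConvexLsc.mem_argmin_iff {R : Euc n → EReal} (hR : ProperConvexLsc R)
    (hf : ∀ i, ConvexOn ℝ Set.univ (f i)) (hd : ∀ i, Differentiable ℝ (f i)) {x : Euc n} :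
    x ∈ argmin (objective R f) ↔ -gradient (avgFun f) x ∈ subdiff R x := by
  constructor
  · exact fun hx => hR.neg_gradient_mem_subdiff (differentiable_avgFun hd x).hasGradientAt hx
  · intro hg y
    obtain ⟨r, hr⟩ := hR.exists_real_of_mem_subdiff hg
    by_cases hy : R y = ⊤
    · simp [objective, hy]
    · obtain ⟨ρ, hρ⟩ := hR.exists_real hy
      have h1 := (hR.mem_subdiff_iff hr).1 hg y ρ hρ
      have h2 := ConvexOn.add_inner_gradient_le (convexOn_avgFun hf) (differentiable_avgFun hd) x y
      rw [inner_neg_left] at h1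
      simp only [objective, hr, hρ]
      exact_mod_cast (by linarith : r + avgFun f x ≤ ρ + avgFun f y)

end Composite


/-! ### Finite identification for partly smooth functions -/

section Identification

variable {n : ℕ}

theorem exists_add_mem_of_mem_intrinsicInterior {C : Set (Euc n)} {g : Euc n}
    (hg : g ∈ intrinsicInterior ℝ C) :
    ∃ ε > 0, ∀ v ∈ vectorSpan ℝ C, ‖v‖ ≤ ε → g + v ∈ C := by
  obtain ⟨y, hy, rfl⟩ := mem_intrinsicInterior.1 hg
  obtain ⟨ε, hε, hball⟩ := Metric.isOpen_iff.1 isOpen_interior y hy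
  refine ⟨ε / 2, by positivity, fun v hv hvε => ?_⟩
  have hmem : v +ᵥ (y : Euc n) ∈ affineSpan ℝ C :=
    AffineSubspace.vadd_mem_of_mem_direction (by rwa [direction_affineSpan]) y.2
  have h1 : (⟨v +ᵥ (y : Euc n), hmem⟩ : affineSpan ℝ C) ∈ Metric.ball y ε := by
    rw [Metric.mem_ball, Subtype.dist_eq]
    simp only [dist_vadd_left]
    linarith
  have h2 := interior_subset (hball h1)
  rw [add_comm]
  exact h2

/-- Points near a `C²`-manifold project onto it along the normal space at a base point. -/
theorem IsC2ManifoldAround.exists_projection {M : Set (Euc n)} {x : Euc n}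
    {T : Submodule ℝ (Euc n)} (hM : IsC2ManifoldAround M x T) :
    ∃ Y : Euc n → Euc n, Tendsto Y (𝓝 x) (𝓝 x) ∧ ∀ᶠ z in 𝓝 x, Y z ∈ M ∧ z - Y z ∈ Tᗮ := by
  obtain ⟨hxM, c, h, hC, hsurj, hloc, hT⟩ := hM
  have hhx : h x = 0 := hloc.self_of_nhds.1 hxM
  -- Since `T = ker h'(x)`, the map `y ↦ (h y, P_T y)` has invertible derivative at `x`. Its local
  -- inverse at `(0, P_T z)` lies on `M` and has the same `T`-component as `z`.
  let D : Euc n →L[ℝ] Euc c × T := (fderiv ℝ h x).prod T.orthogonalProjectionOnto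
  have hker : ∀ v, v ∈ T ↔ fderiv ℝ h x v = 0 := fun v => by
    rw [hT, LinearMap.mem_ker, ContinuousLinearMap.coe_coe]
  have hinj : D.ker = ⊥ := by
    refine LinearMap.ker_eq_bot'.2 fun v hv => ?_
    have h1 : fderiv ℝ h x v = 0 := congrArg Prod.fst hv
    have h2 : T.orthogonalProjectionOnto v = 0 := congrArg Prod.snd hv
    have h3 : T.orthogonalProjectionOnto v = ⟨v, (hker v).2 h1⟩ :=
      Submodule.orthogonalProjectionOnto_mem_subspace_eq_self (K := T) ⟨v, (hker v).2 h1⟩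
    simpa [h3] using h2
  have hrange : D.range = ⊤ := by
    refine LinearMap.range_eq_top.2 fun ⟨a, t⟩ => ?_
    obtain ⟨w, hw⟩ := hsurj a
    refine ⟨w - (T.orthogonalProjectionOnto w : Euc n) + t, ?_⟩
    have h1 : fderiv ℝ h x (T.orthogonalProjectionOnto w : Euc n) = 0 := (hker _).1 (SetLike.coe_mem _)
    have h2 : fderiv ℝ h x (t : Euc n) = 0 := (hker _).1 t.2
    refine Prod.ext ?_ ?_
    · change fderiv ℝ h x (w - (T.orthogonalProjectionOnto w : Euc n) + t) = a
      rw [map_add, map_sub, h1, h2, hw, sub_zero, add_zero]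
    · change T.orthogonalProjectionOnto (w - (T.orthogonalProjectionOnto w : Euc n) + t) = t
      rw [map_add, map_sub, Submodule.orthogonalProjectionOnto_mem_subspace_eq_self,
        Submodule.orthogonalProjectionOnto_mem_subspace_eq_self, sub_self, zero_add]
  let e := ContinuousLinearEquiv.ofBijective D hinj hrange
  have hΨ : HasStrictFDerivAt (fun y => (h y, T.orthogonalProjectionOnto y)) (e : Euc n →L[ℝ] Euc c × T) x := by
    rw [ContinuousLinearEquiv.coe_ofBijective]
    exact (hC.hasStrictFDerivAt (by norm_num)).prodMk T.orthogonalProjectionOnto.hasStrictFDerivAt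
  have hcont : Tendsto (fun z : Euc n => ((0 : Euc c), T.orthogonalProjectionOnto z)) (𝓝 x)
      (𝓝 (h x, T.orthogonalProjectionOnto x)) := by
    rw [hhx]
    exact (Continuous.tendsto (by fun_prop) x)
  have hY : Tendsto (fun z => hΨ.localInverse _ e x (0, T.orthogonalProjectionOnto z)) (𝓝 x) (𝓝 x) := by
    have := hΨ.localInverse_tendsto
    exact this.comp hcont
  refine ⟨_, hY, ?_⟩
  filter_upwards [hcont.eventually hΨ.eventually_right_inverse, hY.eventually hloc] with z h1 h2
  rw [Prod.mk.injEq] at h1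
  refine ⟨h2.2 h1.1, ?_⟩
  rw [← Submodule.orthogonalProjectionOnto_eq_zero_iff, map_sub, h1.2, sub_self]

/-- Finite identification of the active manifold of a partly smooth convex function. -/
theorem PartlySmooth.eventually_mem {R : Euc n → EReal} (hR : ProperConvexLsc R) {x g : Euc n}
    {M : Set (Euc n)} (hM : PartlySmooth R x M) (hg : g ∈ intrinsicInterior ℝ (subdiff R x))
    {xs gs : ℕ → Euc n} (hxs : Tendsto xs atTop (𝓝 x)) (hgs : Tendsto gs atTop (𝓝 g))
    (hmem : ∀ k, gs k ∈ subdiff R (xs k)) : ∀ᶠ k in atTop, xs k ∈ M := by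
  obtain ⟨-, hman, -, hcont, -⟩ := hM
  obtain ⟨Y, hY, hYM⟩ := hman.exists_projection
  obtain ⟨ε, hε, hball⟩ := exists_add_mem_of_mem_intrinsicInterior hg
  rw [Submodule.orthogonal_orthogonal] at hYM
  by_contra hcon
  have hcon' : ∃ᶠ k in atTop, xs k ∉ M := not_eventually.1 hcon
  have hne : (atTop ⊓ 𝓟 {k | xs k ∉ M}).NeBot := frequently_iff_neBot.1 hcon'
  -- An ultrafilter concentrated on the bad indices takes the place of a subsequence along which the
  -- unit normals `ν` converge.
  let l : Ultrafilter ℕ := Ultrafilter.of (atTop ⊓ 𝓟 {k | xs k ∉ M})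
  have hl : (l : Filter ℕ) ≤ atTop ⊓ 𝓟 {k | xs k ∉ M} := Ultrafilter.of_le _
  have hl1 : (l : Filter ℕ) ≤ atTop := hl.trans inf_le_left
  have hl2 : ∀ᶠ k in (l : Filter ℕ), xs k ∉ M := hl.trans inf_le_right (mem_principal_self _)
  replace hxs := hxs.mono_left hl1
  replace hgs := hgs.mono_left hl1
  have hYk := hxs.eventually hYM
  have hYx : Tendsto (fun k => Y (xs k)) l (𝓝 x) := hY.comp hxs
  set d : ℕ → Euc n := fun k => xs k - Y (xs k)
  have hd : ∀ᶠ k in (l : Filter ℕ), d k ≠ 0 := by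
    filter_upwards [hYk, hl2] with k h1 h2 h3
    rw [sub_eq_zero.1 h3] at h2
    exact h2 h1.1
  set ν : ℕ → Euc n := fun k => ‖d k‖⁻¹ • d k
  have hν1 : ∀ᶠ k in (l : Filter ℕ), ν k ∈ Metric.sphere (0 : Euc n) 1 := by
    filter_upwards [hd] with k hk
    simp [ν, norm_smul, inv_mul_cancel₀ (norm_ne_zero_iff.2 hk)]
  obtain ⟨ν₀, hν₀, hlim⟩ := (isCompact_sphere (0 : Euc n) 1).ultrafilter_le_nhds
    (l.map ν) (le_principal_iff.2 hν1)
  have hlim' : Tendsto ν l (𝓝 ν₀) := hlim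
  have hν₀T : ν₀ ∈ vectorSpan ℝ (subdiff R x) := by
    refine (Submodule.closed_of_finiteDimensional (vectorSpan ℝ (subdiff R x))).mem_of_tendsto
      hlim' ?_
    filter_upwards [hYk] with k hk
    exact Submodule.smul_mem _ _ hk.2
  have hν₀1 : ‖ν₀‖ = 1 := by simpa using hν₀
  -- Non-degeneracy leaves room to move from `g` in the normal direction `ν₀`; inner semi-continuity
  -- then provides subgradients `w` at the projected points close to `g + ε ν₀`.
  have hmem₀ : g + ε • ν₀ ∈ subdiff R x := by
    refine hball _ (Submodule.smul_mem _ _ hν₀T) ?_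
    rw [norm_smul, hν₀1, mul_one, Real.norm_of_nonneg hε.le]
  have hV := hcont _ hmem₀ (Metric.ball _ (ε / 4)) (Metric.ball_mem_nhds _ (by positivity))
  have hYM' : Tendsto (fun k => Y (xs k)) l (𝓝[M] x) :=
    tendsto_nhdsWithin_iff.2 ⟨hYx, hYk.mono fun k hk => hk.1⟩
  -- Two errors of size `ε / 4` against a gain above `3 ε / 4` make `⟪gs k - w, ν k⟫` negative,
  -- whereas monotonicity makes it nonnegative.
  have hinner : ∀ᶠ k in (l : Filter ℕ), 3 / 4 < inner ℝ ν₀ (ν k) := by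
    have h1 : Tendsto (fun k => inner ℝ ν₀ (ν k)) l (𝓝 (inner ℝ ν₀ ν₀)) :=
      tendsto_const_nhds.inner hlim'
    rw [real_inner_self_eq_norm_sq, hν₀1] at h1
    exact h1.eventually_const_lt (by norm_num)
  obtain ⟨k, ⟨w, hw, hwV⟩, hk2, hk3, hk4, hk5⟩ := ((hYM'.eventually hV).and (hinner.and
    ((hgs.eventually (Metric.ball_mem_nhds g (show 0 < ε / 4 by positivity))).and
      (hν1.and hd)))).exists
  have hνk : ‖ν k‖ = 1 := by simpa using hk4
  have h1 : 0 ≤ inner ℝ (gs k - w) (ν k) := by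
    simp only [ν, inner_smul_right]
    exact mul_nonneg (by positivity) (hR.subdiff_monotone (hmem k) hw)
  have h2 : gs k - w = (gs k - g) - ε • ν₀ - (w - (g + ε • ν₀)) := by abel
  have h3 := (real_inner_le_norm (gs k - g) (ν k))
  have h4 := (abs_le.1 (abs_real_inner_le_norm (w - (g + ε • ν₀)) (ν k))).1
  rw [Metric.mem_ball, dist_eq_norm] at hwV
  rw [dist_eq_norm] at hk3
  rw [h2, inner_sub_left, inner_sub_left, inner_smul_left] at h1
  simp only [conj_trivial] at h1
  rw [hνk] at h3 h4
  nlinarith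

end Identification


/-! ### Averages over the index set and the variance identity -/

section Mean

variable {n m : ℕ}

/-- The average of `m` real numbers. -/
noncomputable def mean (a : Fin m → ℝ) : ℝ := (1 / (m : ℝ)) * ∑ i, a i

theorem mean_add (a b : Fin m → ℝ) : mean (fun i => a i + b i) = mean a + mean b := by
  simp [mean, Finset.sum_add_distrib, mul_add]

theorem mean_sub (a b : Fin m → ℝ) : mean (fun i => a i - b i) = mean a - mean b := by
  simp [mean, Finset.sum_sub_distrib, mul_sub]

theorem mean_mul_left (c : ℝ) (a : Fin m → ℝ) : mean (fun i => c * a i) = c * mean a := by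
  simp only [mean, ← Finset.mul_sum]
  ring

theorem mean_const (hm : 0 < m) (c : ℝ) : mean (fun _ : Fin m => c) = c := by
  have : (m : ℝ) ≠ 0 := by positivity
  simp [mean, this]

theorem mean_mono {a b : Fin m → ℝ} (h : ∀ i, a i ≤ b i) : mean a ≤ mean b := by
  unfold mean
  gcongr with i
  exact h i

theorem mean_nonneg {a : Fin m → ℝ} (h : ∀ i, 0 ≤ a i) : 0 ≤ mean a := by
  have := Finset.sum_nonneg fun i (_ : i ∈ Finset.univ) => h i
  unfold mean
  positivity

theorem le_card_mul_mean {a : Fin m → ℝ} (h : ∀ i, 0 ≤ a i) (j : Fin m) :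
    a j ≤ m * mean a := by
  have hm : (m : ℝ) ≠ 0 := by
    have := j.pos
    positivity
  rw [mean, ← mul_assoc, mul_one_div_cancel hm, one_mul]
  exact Finset.single_le_sum (fun i _ => h i) (Finset.mem_univ j)

theorem mean_update (a : Fin m → ℝ) (j : Fin m) (c : ℝ) :
    mean (Function.update a j c) = mean a + (1 / (m : ℝ)) * (c - a j) := by
  rw [mean, Finset.sum_update_of_mem (Finset.mem_univ j), mean,
    ← Finset.add_sum_erase _ a (Finset.mem_univ j), Finset.sdiff_singleton_eq_erase]
  ring

theorem mean_inner (v : Euc n) (b : Fin m → Euc n) :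
    mean (fun i => inner ℝ v (b i)) = inner ℝ v (avgVec b) := by
  simp [mean, avgVec, inner_smul_right, inner_sum]

theorem avgVec_sub (a b : Fin m → Euc n) : avgVec (fun i => a i - b i) = avgVec a - avgVec b := by
  simp [avgVec, Finset.sum_sub_distrib, smul_sub]

theorem avgVec_const (hm : 0 < m) (v : Euc n) : avgVec (fun _ : Fin m => v) = v := by
  have : (m : ℝ) ≠ 0 := by positivity
  simp [avgVec, ← Nat.cast_smul_eq_nsmul ℝ, smul_smul, this]

theorem mean_norm_sub_avgVec_sq (hm : 0 < m) (q : Fin m → Euc n) :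
    mean (fun i => ‖q i - avgVec q‖ ^ 2) = mean (fun i => ‖q i‖ ^ 2) - ‖avgVec q‖ ^ 2 := by
  have h : ∀ i, ‖q i - avgVec q‖ ^ 2 =
      ‖q i‖ ^ 2 - 2 * inner ℝ (avgVec q) (q i) + ‖avgVec q‖ ^ 2 := fun i => by
    rw [norm_sub_sq_real, real_inner_comm]
  simp only [h, mean_add, mean_sub, mean_mul_left, mean_inner, mean_const hm,
    real_inner_self_eq_norm_sq]
  ring

theorem norm_avgVec_sq_le (hm : 0 < m) (q : Fin m → Euc n) :
    ‖avgVec q‖ ^ 2 ≤ mean fun i => ‖q i‖ ^ 2 := by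
  have h1 := mean_norm_sub_avgVec_sq hm q
  have h2 : 0 ≤ mean fun i => ‖q i - avgVec q‖ ^ 2 := mean_nonneg fun i => by positivity
  linarith

end Mean

/-! ### The one-step estimate -/

section Step

variable {n m : ℕ}

/-- The mean squared distance of a table of gradients to the gradients at `u`. -/
noncomputable def gap (f : Fin m → Euc n → ℝ) (u : Euc n) (g : Fin m → Euc n) : ℝ :=
  mean fun i => ‖g i - gradient (f i) u‖ ^ 2

/-- The variance-reduced gradient estimator. -/
noncomputable def estimator (f : Fin m → Euc n → ℝ) (x : Euc n) (g : Fin m → Euc n) (j : Fin m) :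
    Euc n :=
  gradient (f j) x - g j + avgVec g

/-- One step of a variance-reduced proximal gradient method. -/
noncomputable def proxStep (γ : ℝ) (R : Euc n → EReal) (f : Fin m → Euc n → ℝ) (x : Euc n)
    (g : Fin m → Euc n) (j : Fin m) : Euc n :=
  prox γ R (x - γ • estimator f x g j)

/-- The mean squared deviation of the dual iterate from `-∇F(u)`, up to the factor `γ²`. -/
noncomputable def residual (γ : ℝ) (R : Euc n → EReal) (f : Fin m → Euc n → ℝ) (u x : Euc n)
    (g : Fin m → Euc n) : ℝ :=
  mean fun j => ‖x - γ • estimator f x g j - proxStep γ R f x g j +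
    γ • gradient (avgFun f) u‖ ^ 2

theorem gap_nonneg (f : Fin m → Euc n → ℝ) (u : Euc n) (g : Fin m → Euc n) : 0 ≤ gap f u g :=
  mean_nonneg fun _ => by positivity

theorem residual_nonneg (γ : ℝ) (R : Euc n → EReal) (f : Fin m → Euc n → ℝ) (u x : Euc n)
    (g : Fin m → Euc n) : 0 ≤ residual γ R f u x g :=
  mean_nonneg fun _ => by positivity

/-- Firm nonexpansiveness is applied with the subgradient `-∇F(u)` at `u` and averaged over `j`.
Cocoercivity of each `f j` bounds the linear term. In the quadratic term the error is `b j` minus a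
centred vector, and a variance is at most the second moment. -/
theorem mean_norm_proxStep_sub_sq_le (hm : 0 < m) {R : Euc n → EReal} (hR : ProperConvexLsc R)
    {f : Fin m → Euc n → ℝ} (hf : ∀ i, ConvexOn ℝ Set.univ (f i))
    (hd : ∀ i, Differentiable ℝ (f i)) {L : ℝ} (hL0 : 0 < L)
    (hL : ∀ i x y, ‖gradient (f i) x - gradient (f i) y‖ ≤ L * ‖x - y‖) {γ : ℝ} (hγ : 0 < γ)
    {u : Euc n} (hu : -gradient (avgFun f) u ∈ subdiff R u) (x : Euc n) (g : Fin m → Euc n) :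
    mean (fun j => ‖proxStep γ R f x g j - u‖ ^ 2) + residual γ R f u x g ≤
      ‖x - u‖ ^ 2 - (2 * γ / L - 2 * γ ^ 2) * gap f u (fun i => gradient (f i) x) +
        2 * γ ^ 2 * gap f u g := by
  set c := gradient (avgFun f) u
  set b : Fin m → Euc n := fun i => gradient (f i) x - gradient (f i) u
  set q : Fin m → Euc n := fun i => g i - gradient (f i) u
  have hc : c = avgVec fun i => gradient (f i) u := gradient_avgFun hd u
  set e : Fin m → Euc n := fun j => estimator f x g j - c
  have he : ∀ j, e j = b j - (q j - avgVec q) := by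
    intro j
    simp only [e, b, q, estimator, avgVec_sub, hc]
    abel
  have h1 : ∀ j, ‖proxStep γ R f x g j - u‖ ^ 2 +
      ‖x - γ • estimator f x g j - proxStep γ R f x g j + γ • c‖ ^ 2 ≤
      ‖x - u‖ ^ 2 - 2 * γ * inner ℝ (x - u) (e j) + γ ^ 2 * ‖e j‖ ^ 2 := by
    intro j
    have h := hR.norm_prox_sub_sq_add_le hu hγ (x - γ • estimator f x g j)
    rw [smul_neg, sub_neg_eq_add, sub_neg_eq_add] at h
    refine h.trans (le_of_eq ?_)
    rw [show x - γ • estimator f x g j - u + γ • c = (x - u) - γ • e j by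
      simp only [e]; module, norm_sub_sq_real, inner_smul_right, norm_smul, mul_pow,
      Real.norm_eq_abs, sq_abs]
    ring
  have h2 := mean_mono h1
  rw [mean_add, mean_add, mean_sub, mean_const hm, mean_mul_left, mean_mul_left] at h2
  -- Unbiasedness of the estimator: the vectors `q j - avgVec q` average to zero.
  have h3 : mean (fun j => inner ℝ (x - u) (e j)) = mean fun j => inner ℝ (x - u) (b j) := by
    rw [mean_inner, mean_inner, funext he, avgVec_sub b,
      avgVec_sub q, avgVec_const hm, sub_self, sub_zero]
  have h4 : 1 / L * gap f u (fun i => gradient (f i) x) ≤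
      mean fun j => inner ℝ (x - u) (b j) := by
    rw [gap, ← mean_mul_left]
    refine mean_mono fun j => ?_
    rw [real_inner_comm]
    exact norm_gradient_sub_sq_le hL0 (hf j) (hd j) (hL j) x u
  have h5 : mean (fun j => ‖e j‖ ^ 2) ≤
      2 * gap f u (fun i => gradient (f i) x) + 2 * gap f u g := by
    have h6 : ∀ j, ‖e j‖ ^ 2 ≤ 2 * ‖b j‖ ^ 2 + 2 * ‖q j - avgVec q‖ ^ 2 := by
      intro j
      rw [he]
      have := parallelogram_law_with_norm ℝ (b j) (q j - avgVec q)
      nlinarith [sq_nonneg ‖b j + (q j - avgVec q)‖]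
    refine (mean_mono h6).trans ?_
    rw [mean_add, mean_mul_left, mean_mul_left, mean_norm_sub_avgVec_sq hm]
    have : 0 ≤ ‖avgVec q‖ ^ 2 := by positivity
    simp only [gap]
    linarith
  rw [h3] at h2
  have h7 := mul_le_mul_of_nonneg_left h4 (show 0 ≤ 2 * γ by positivity)
  have h8 := mul_le_mul_of_nonneg_left h5 (sq_nonneg γ)
  have h9 : 2 * γ * (1 / L * gap f u fun i => gradient (f i) x) =
      2 * γ / L * gap f u fun i => gradient (f i) x := by ring
  simp only [residual]
  linarith

end Step

/-! ### Opial's lemma and the abstract convergence theorem -/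

section Convergence

variable {n m : ℕ}

/-- Opial's lemma for a sequence that is Fejér monotone in the limit with respect to a dense
subset of a set containing all its cluster points. -/
theorem exists_tendsto_of_tendsto_norm_sub {A D : Set (Euc n)} (hDA : A ⊆ closure D)
    (hD : D.Nonempty) {X : ℕ → Euc n}
    (hX : ∀ u ∈ D, ∃ c, Tendsto (fun k => ‖X k - u‖) atTop (𝓝 c))
    (hcl : ∀ x, MapClusterPt x atTop X → x ∈ A) : ∃ x ∈ A, Tendsto X atTop (𝓝 x) := by
  obtain ⟨u₀, hu₀⟩ := hD
  obtain ⟨c₀, hc₀⟩ := hX u₀ hu₀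
  have hbdd : ∀ᶠ k in atTop, X k ∈ Metric.closedBall u₀ (c₀ + 1) := by
    filter_upwards [hc₀.eventually_lt_const (lt_add_one c₀)] with k hk
    rw [mem_closedBall_iff_norm]
    exact hk.le
  obtain ⟨x, -, hx⟩ := (isCompact_closedBall u₀ (c₀ + 1)).exists_mapClusterPt
    (le_principal_iff.2 hbdd)
  refine ⟨x, hcl x hx, Metric.tendsto_nhds.2 fun ε hε => ?_⟩
  obtain ⟨u, hu, hxu⟩ := Metric.mem_closure_iff.1 (hDA (hcl x hx)) (ε / 4) (by positivity)
  obtain ⟨c, hc⟩ := hX u hu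
  -- The cluster point `x` need not lie in `D`, so the distances are measured to a nearby `u ∈ D`;
  -- as they converge, a bound holding frequently bounds their limit.
  have hfreq : ∃ᶠ k in atTop, ‖X k - u‖ ≤ ε / 2 := by
    refine (hx.frequently (Metric.ball_mem_nhds x (show 0 < ε / 4 by positivity))).mono
      fun k hk => ?_
    have h1 := dist_triangle (X k) x u
    rw [← dist_eq_norm]
    have h2 : dist (X k) x < ε / 4 := hk
    linarith
  have hcε : c ≤ ε / 2 := le_of_tendsto_of_frequently hc hfreq
  filter_upwards [hc.eventually_lt_const (show c < 3 * ε / 4 by linarith)] with k hk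
  have h1 := dist_triangle_right (X k) x u
  rw [← dist_eq_norm] at hk
  linarith

/-- Almost sure convergence and finite identification for a variance-reduced proximal gradient
method that admits a suitable Lyapunov function for each minimiser. -/
theorem exists_ae_tendsto_of_lyapunov (hm : 0 < m) {R : Euc n → EReal} (hR : ProperConvexLsc R)
    {f : Fin m → Euc n → ℝ} (hf : ∀ i, ConvexOn ℝ Set.univ (f i)) (hd : ∀ i, Differentiable ℝ (f i))
    (hcont : ∀ i, Continuous (gradient (f i))) (hmin : (argmin (objective R f)).Nonempty)
    {γ : ℝ} (hγ : 0 < γ) {Ω : Type*} [MeasurableSpace Ω] {μ : Measure Ω} [IsProbabilityMeasure μ]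
    {s : ℕ → Ω → Fin m} (hs : IIDUniform s μ) {x : ℕ → (ℕ → Fin m) → Euc n}
    {g : ℕ → (ℕ → Fin m) → Fin m → Euc n} (hx : ∀ k, DependsOn (x k) (Set.Iio k))
    (hstep : ∀ k t, x (k + 1) t = proxStep γ R f (x k t) (g k t) (t k))
    (hlyap : ∀ u, -gradient (avgFun f) u ∈ subdiff R u →
      ∃ (E U : ℕ → (ℕ → Fin m) → ℝ) (ε : ℝ), 0 < ε ∧
        (∀ k, DependsOn (E k) (Set.Iio k)) ∧ (∀ k, DependsOn (U k) (Set.Iio k)) ∧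
        (∀ k t, 0 ≤ E k t) ∧
        (∀ k t, ε * gap f u (fun i => gradient (f i) (x k t)) + residual γ R f u (x k t) (g k t) ≤
          U k t) ∧
        (∀ k t, mean (fun j => ‖x (k + 1) (Function.update t k j) - u‖ ^ 2 +
          E (k + 1) (Function.update t k j)) ≤ ‖x k t - u‖ ^ 2 + E k t - U k t) ∧
        ∀ t, Tendsto (fun k => U k t) atTop (𝓝 0) → Tendsto (fun k => E k t) atTop (𝓝 0)) :
    ∃ xs : Ω → Euc n, Measurable xs ∧ ∀ᵐ ω ∂μ, xs ω ∈ argmin (objective R f) ∧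
      Tendsto (fun k => x k fun j => s j ω) atTop (𝓝 (xs ω)) ∧
      ∀ M : Set (Euc n), PartlySmooth R (xs ω) M → NonDegenerate R (avgFun f) (xs ω) →
        ∃ K : ℕ, ∀ k ≥ K, x k (fun j => s j ω) ∈ M := by
  have hargmin : ∀ {u}, u ∈ argmin (objective R f) ↔ -gradient (avgFun f) u ∈ subdiff R u :=
    hR.mem_argmin_iff hf hd
  have hgcont : Continuous (gradient (avgFun f)) := by
    have : gradient (avgFun f) = fun x => avgVec fun i => gradient (f i) x :=
      funext fun x => gradient_avgFun hd x
    rw [this]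
    unfold avgVec
    fun_prop
  have hone : ∀ u ∈ argmin (objective R f), ∀ᵐ ω ∂μ,
      (∃ c, Tendsto (fun k => ‖x k (fun j => s j ω) - u‖) atTop (𝓝 c)) ∧
      Tendsto (fun k => gradient (avgFun f) (x k fun j => s j ω)) atTop
        (𝓝 (gradient (avgFun f) u)) ∧
      Tendsto (fun k => (1 / γ) • (x k (fun j => s j ω) -
        γ • estimator f (x k fun j => s j ω) (g k fun j => s j ω) (s k ω) -
          x (k + 1) fun j => s j ω)) atTop (𝓝 (-gradient (avgFun f) u)) := by
    intro u hu
    obtain ⟨E, U, ε, hε, hE, hU, hE0, hUge, hdec, hlim⟩ := hlyap u (hargmin.1 hu)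
    have hU0 : ∀ k t, 0 ≤ U k t := fun k t => le_trans
      (add_nonneg (mul_nonneg hε.le (gap_nonneg _ _ _)) (residual_nonneg _ _ _ _ _ _)) (hUge k t)
    filter_upwards [ae_tendsto_of_average_decrease hs hm
      (V := fun k t => ‖x k t - u‖ ^ 2 + E k t) (U := U)
      (fun k t t' h => by simp only; rw [hx k h, hE k h]) hU
      (fun k t => add_nonneg (by positivity) (hE0 k t)) hU0 hdec] with ω ⟨⟨c, hc⟩, hUlim⟩
    set t : ℕ → Fin m := fun j => s j ω
    have hEt := hlim t hUlim
    refine ⟨⟨√c, ?_⟩, ?_, ?_⟩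
    · have h1 : Tendsto (fun k => ‖x k t - u‖ ^ 2) atTop (𝓝 c) := by
        simpa using hc.sub hEt
      simpa [Real.sqrt_sq] using h1.sqrt
    · refine tendsto_iff_norm_sub_tendsto_zero.2 ?_
      have h1 : Tendsto (fun k => ‖gradient (avgFun f) (x k t) - gradient (avgFun f) u‖ ^ 2) atTop
          (𝓝 0) := by
        refine squeeze_zero (fun k => by positivity) (fun k => ?_)
          (by simpa using hUlim.const_mul (1 / ε))
        rw [gradient_avgFun hd, gradient_avgFun hd, ← avgVec_sub]
        refine (norm_avgVec_sq_le hm _).trans ?_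
        rw [inv_mul_eq_div, le_div_iff₀ hε, mul_comm]
        have h2 := hUge k t
        have h3 := residual_nonneg γ R f u (x k t) (g k t)
        simp only [gap] at h2
        linarith
      simpa [Real.sqrt_sq] using h1.sqrt
    · refine tendsto_iff_norm_sub_tendsto_zero.2 ?_
      have h1 : Tendsto (fun k => ‖x k t - γ • estimator f (x k t) (g k t) (t k) - x (k + 1) t +
          γ • gradient (avgFun f) u‖ ^ 2) atTop (𝓝 0) := by
        refine squeeze_zero (fun k => by positivity) (fun k => ?_)
          (by simpa using hUlim.const_mul (m : ℝ))
        rw [hstep]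
        refine (le_card_mul_mean (a := fun j => ‖x k t - γ • estimator f (x k t) (g k t) j -
          proxStep γ R f (x k t) (g k t) j + γ • gradient (avgFun f) u‖ ^ 2)
          (fun j => by positivity) (t k)).trans ?_
        have h2 := hUge k t
        have h3 := mul_nonneg hε.le (gap_nonneg f u fun i => gradient (f i) (x k t))
        simp only [residual] at h2
        exact mul_le_mul_of_nonneg_left (by linarith) (by positivity)
      have h2 : Tendsto (fun k => (1 / γ) * ‖x k t - γ • estimator f (x k t) (g k t) (t k) -
          x (k + 1) t + γ • gradient (avgFun f) u‖) atTop (𝓝 0) := by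
        simpa [Real.sqrt_sq] using h1.sqrt.const_mul (1 / γ)
      refine h2.congr fun k => ?_
      rw [sub_neg_eq_add]
      nth_rewrite 1 [← Real.norm_of_nonneg (show 0 ≤ 1 / γ by positivity)]
      rw [← norm_smul, smul_add, smul_smul _ γ, one_div_mul_cancel hγ.ne', one_smul]
  -- The exceptional null set in `hone` depends on the minimiser; a countable dense set of
  -- minimisers leaves a single one.
  obtain ⟨D, hDsub, hDc, hDd⟩ := (TopologicalSpace.IsSeparable.of_separableSpace
    (argmin (objective R f))).exists_countable_dense_subset
  have hDne : D.Nonempty := closure_nonempty_iff.1 (hmin.mono hDd)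
  have hmain : ∀ᵐ ω ∂μ, ∃ y ∈ argmin (objective R f),
      Tendsto (fun k => x k fun j => s j ω) atTop (𝓝 y) ∧
      ∀ M : Set (Euc n), PartlySmooth R y M → NonDegenerate R (avgFun f) y →
        ∃ K : ℕ, ∀ k ≥ K, x k (fun j => s j ω) ∈ M := by
    filter_upwards [(ae_ball_iff hDc).2 fun u hu => hone u (hDsub hu)] with ω hω
    set t : ℕ → Fin m := fun j => s j ω
    obtain ⟨u₀, hu₀⟩ := hDne
    obtain ⟨-, hgrad, hdual⟩ := hω u₀ hu₀
    have hmem : ∀ k, (1 / γ) • (x k t - γ • estimator f (x k t) (g k t) (t k) - x (k + 1) t) ∈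
        subdiff R (x (k + 1) t) := by
      intro k
      rw [hstep]
      exact hR.prox_mem_subdiff (hargmin.1 (hDsub hu₀)) hγ _
    have hgrad' := hgrad.comp (tendsto_add_atTop_nat 1)
    -- The index is shifted because the prox supplies a subgradient only from `x 1` on; `x 0` may
    -- lie outside the domain of `R`.
    obtain ⟨y, hy, hlim⟩ := exists_tendsto_of_tendsto_norm_sub (X := fun k => x (k + 1) t)
      hDd ⟨u₀, hu₀⟩ (fun u hu => by
        obtain ⟨c, hc⟩ := (hω u hu).1
        exact ⟨c, hc.comp (tendsto_add_atTop_nat 1)⟩) (fun z hz => by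
        obtain ⟨l, hl, hlz⟩ := mapClusterPt_iff_ultrafilter.1 hz
        have h1 := hR.mem_subdiff_of_tendsto hlz (hdual.mono_left hl)
          (Eventually.of_forall hmem)
        have h2 : gradient (avgFun f) z = gradient (avgFun f) u₀ :=
          tendsto_nhds_unique ((hgcont.tendsto z).comp hlz) (hgrad'.mono_left hl)
        rw [← h2] at h1
        exact hargmin.2 h1)
    refine ⟨y, hy, (tendsto_add_atTop_iff_nat (f := fun k => x k t) 1).1 hlim,
      fun M hM hnd => ?_⟩
    have h2 : gradient (avgFun f) y = gradient (avgFun f) u₀ :=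
      tendsto_nhds_unique ((hgcont.tendsto y).comp hlim) hgrad'
    rw [← h2] at hdual
    obtain ⟨K, hK⟩ := eventually_atTop.1 (hM.eventually_mem hR hnd hlim hdual hmem)
    refine ⟨K + 1, fun k hk => ?_⟩
    obtain ⟨k, rfl⟩ : ∃ l, k = l + 1 := ⟨k - 1, by omega⟩
    exact hK k (by omega)
  obtain ⟨xs, hxs, hxslim⟩ := measurable_limit_of_tendsto_metrizable_ae (μ := μ)
    (f := fun k ω => x k fun j => s j ω) (L := atTop)
    (fun k => ((measurable_pastFiltration_of_dependsOn hs.measurable (hx k)).mono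
      ((pastFiltration s hs.measurable).le k) le_rfl).aemeasurable)
    (hmain.mono fun ω ⟨y, _, hy, _⟩ => ⟨y, hy⟩)
  refine ⟨xs, hxs, ?_⟩
  filter_upwards [hmain, hxslim] with ω ⟨y, hy, hylim, hid⟩ hlim
  obtain rfl := tendsto_nhds_unique hylim hlim
  exact ⟨hy, hylim, hid⟩

end Convergence


/-! ### The Lyapunov function for SAGA -/

section Saga

variable {n m : ℕ} {R : Euc n → EReal} {f : Fin m → Euc n → ℝ} {γ : ℝ} {x₀ : Euc n}

theorem dependsOn_sagaState (k : ℕ) :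
    DependsOn (fun t => sagaState R f γ x₀ t k) (Set.Iio k) := by
  induction k with
  | zero => intro t t' _; rfl
  | succ k ih =>
    intro t t' h
    have h1 : sagaState R f γ x₀ t k = sagaState R f γ x₀ t' k :=
      ih fun i hi => h i (lt_trans (Set.mem_Iio.1 hi) (Nat.lt_succ_self k))
    have h2 : t k = t' k := h k (Nat.lt_succ_self k)
    simp only [sagaState, h1, h2]

theorem gap_update (u : Euc n) (g : Fin m → Euc n) (j : Fin m) (v : Euc n) :
    gap f u (Function.update g j v) = gap f u g +
      (1 / (m : ℝ)) * (‖v - gradient (f j) u‖ ^ 2 - ‖g j - gradient (f j) u‖ ^ 2) := by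
  unfold gap
  rw [← mean_update (fun i => ‖g i - gradient (f i) u‖ ^ 2)]
  congr 1
  ext i
  rcases eq_or_ne i j with rfl | h <;> simp [*]

theorem exists_ae_tendsto_saga (hm : 0 < m) (hR : ProperConvexLsc R)
    (hf : ∀ i, ConvexOn ℝ Set.univ (f i)) (hd : ∀ i, Differentiable ℝ (f i)) {L : ℝ} (hL0 : 0 < L)
    (hL : ∀ i x y, ‖gradient (f i) x - gradient (f i) y‖ ≤ L * ‖x - y‖)
    (hcont : ∀ i, Continuous (gradient (f i))) (hmin : (argmin (objective R f)).Nonempty)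
    (hγ : γ = 1 / (3 * L)) {Ω : Type*} [MeasurableSpace Ω] {μ : Measure Ω} [IsProbabilityMeasure μ]
    {s : ℕ → Ω → Fin m} (hs : IIDUniform s μ) :
    ∃ xs : Ω → Euc n, Measurable xs ∧ ∀ᵐ ω ∂μ, xs ω ∈ argmin (objective R f) ∧
      Tendsto (fun k => saga R f γ x₀ (fun j => s j ω) k) atTop (𝓝 (xs ω)) ∧
      ∀ M : Set (Euc n), PartlySmooth R (xs ω) M → NonDegenerate R (avgFun f) (xs ω) →
        ∃ K : ℕ, ∀ k ≥ K, saga R f γ x₀ (fun j => s j ω) k ∈ M := by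
  have hγ0 : 0 < γ := by rw [hγ]; positivity
  have hm' : (m : ℝ) ≠ 0 := by positivity
  have hγL : 2 * γ / L = 6 * γ ^ 2 := by rw [hγ]; field_simp; norm_num
  let x : ℕ → (ℕ → Fin m) → Euc n := fun k t => saga R f γ x₀ t k
  let g : ℕ → (ℕ → Fin m) → Fin m → Euc n := fun k t => (sagaState R f γ x₀ t k).2
  have hx : ∀ k, DependsOn (x k) (Set.Iio k) := fun k t t' h =>
    congrArg Prod.fst (dependsOn_sagaState k h)
  have hg : ∀ k, DependsOn (g k) (Set.Iio k) := fun k t t' h =>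
    congrArg Prod.snd (dependsOn_sagaState k h)
  have hupd : ∀ k (t : ℕ → Fin m) j, ∀ i ∈ Set.Iio k, Function.update t k j i = t i :=
    fun k t j i hi => Function.update_of_ne (ne_of_lt hi) _ _
  have hstep : ∀ k t, x (k + 1) t = proxStep γ R f (x k t) (g k t) (t k) := fun k t => rfl
  have hgstep : ∀ k t, g (k + 1) t =
      Function.update (g k t) (t k) (gradient (f (t k)) (x k t)) := fun k t => rfl
  refine exists_ae_tendsto_of_lyapunov hm hR hf hd hcont hmin hγ0 hs hx hstep fun u hu => ?_
  have hgap0 := gap_nonneg f u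
  -- Overwriting one entry changes `gap(g)` on average by `(gap(x) - gap(g)) / m`. With `2γ/L = 6γ²`
  -- the step contributes `-4γ² gap(x) + 2γ² gap(g)`, so the weight `3mγ²` leaves `-γ²` times each
  -- gap; the one in `gap(g)` forces `E → 0`.
  refine ⟨fun k t => 3 * m * γ ^ 2 * gap f u (g k t), fun k t =>
    γ ^ 2 * gap f u (fun i => gradient (f i) (x k t)) + γ ^ 2 * gap f u (g k t) +
      residual γ R f u (x k t) (g k t), γ ^ 2, by positivity, ?_, ?_, ?_, ?_, ?_, ?_⟩
  · intro k t t' h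
    simp only [hg k h]
  · intro k t t' h
    simp only [hg k h, hx k h]
  · intro k t
    have := hgap0 (g k t)
    positivity
  · intro k t
    have := hgap0 (g k t)
    have : 0 ≤ γ ^ 2 * gap f u (g k t) := by positivity
    linarith
  · intro k t
    have h1 : ∀ j, x (k + 1) (Function.update t k j) = proxStep γ R f (x k t) (g k t) j := fun j => by
      rw [hstep, hx k (hupd k t j), hg k (hupd k t j), Function.update_self]
    have h2 : ∀ j, g (k + 1) (Function.update t k j) =
        Function.update (g k t) j (gradient (f j) (x k t)) := fun j => by
      rw [hgstep, hx k (hupd k t j), hg k (hupd k t j), Function.update_self]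
    have h3 := mean_norm_proxStep_sub_sq_le hm hR hf hd hL0 hL hγ0 hu (x k t) (g k t)
    have h4 : 3 * (m : ℝ) * γ ^ 2 * (1 / (m : ℝ) *
        (gap f u (fun i => gradient (f i) (x k t)) - gap f u (g k t))) =
        3 * γ ^ 2 * (gap f u (fun i => gradient (f i) (x k t)) - gap f u (g k t)) := by
      field_simp
    have h5 : mean (fun j => 3 * m * γ ^ 2 *
        gap f u (Function.update (g k t) j (gradient (f j) (x k t)))) =
        3 * m * γ ^ 2 * (gap f u (g k t) + 1 / (m : ℝ) *
          (gap f u (fun i => gradient (f i) (x k t)) - gap f u (g k t))) := by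
      simp only [gap_update]
      rw [mean_mul_left, mean_add, mean_const hm, mean_mul_left, mean_sub]
      rfl
    simp only [h1, h2]
    rw [mean_add, h5]
    rw [hγL] at h3
    linarith
  · intro t ht
    refine squeeze_zero (fun k => ?_) (fun k => ?_) (by simpa using ht.const_mul (3 * (m : ℝ)))
    · have := hgap0 (g k t)
      positivity
    · have h1 := residual_nonneg γ R f u (x k t) (g k t)
      have h2 := hgap0 fun i => gradient (f i) (x k t)
      have h3 : 0 ≤ γ ^ 2 * gap f u (fun i => gradient (f i) (x k t)) := by positivity
      change 3 * (m : ℝ) * γ ^ 2 * gap f u (g k t) ≤ _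
      rw [mul_assoc (3 * (m : ℝ))]
      exact mul_le_mul_of_nonneg_left (by linarith) (by positivity)

end Saga

/-! ### The Lyapunov function for Prox-SVRG -/

section Svrg

variable {n m : ℕ} {R : Euc n → EReal} {f : Fin m → Euc n → ℝ} {γ : ℝ} {x₀ : Euc n} {P : ℕ}

theorem svrgInner_congr {xt : Euc n} {t t' : ℕ → Fin m} {p : ℕ} (h : ∀ i < p, t i = t' i) :
    svrgInner R f γ xt t p = svrgInner R f γ xt t' p := by
  induction p with
  | zero => rfl
  | succ p ih => simp only [svrgInner, ih fun i hi => h i (by omega), h p (Nat.lt_succ_self p)]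

theorem svrgOuter_congr {t t' : ℕ → Fin m} {l : ℕ} (h : ∀ i < l * P, t i = t' i) :
    svrgOuter R f γ P x₀ t l = svrgOuter R f γ P x₀ t' l := by
  induction l with
  | zero => rfl
  | succ l ih =>
    rw [Nat.succ_mul] at h
    simp only [svrgOuter, ih fun i hi => h i (by omega)]
    exact svrgInner_congr fun i hi => h _ (by omega)

theorem dependsOn_svrgOuter_div (k : ℕ) :
    DependsOn (fun t => svrgOuter R f γ P x₀ t (k / P)) (Set.Iio k) := fun _ _ h =>
  svrgOuter_congr fun i hi => h i (lt_of_lt_of_le hi (Nat.div_mul_le_self k P))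

theorem dependsOn_svrg (k : ℕ) : DependsOn (fun t => svrg R f γ P x₀ t k) (Set.Iio k) := by
  intro t t' h
  have h1 : svrgOuter R f γ P x₀ t (k / P) = svrgOuter R f γ P x₀ t' (k / P) :=
    dependsOn_svrgOuter_div k h
  simp only [svrg, h1]
  refine svrgInner_congr fun i hi => h _ ?_
  have := Nat.div_add_mod' k P
  simp only [Set.mem_Iio]
  omega

theorem succ_div_mod_of_lt (hP : 0 < P) {k : ℕ} (h : k % P + 1 < P) :
    (k + 1) / P = k / P ∧ (k + 1) % P = k % P + 1 := by
  have h1 := Nat.div_add_mod' k P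
  have h2 : k + 1 = (k % P + 1) + P * (k / P) := by rw [mul_comm]; omega
  rw [h2, Nat.add_mul_div_left _ _ hP, Nat.div_eq_of_lt h, Nat.add_mul_mod_self_left,
    Nat.mod_eq_of_lt h]
  simp

theorem succ_div_mod_of_eq (hP : 0 < P) {k : ℕ} (h : k % P + 1 = P) :
    (k + 1) / P = k / P + 1 ∧ (k + 1) % P = 0 := by
  have h1 := Nat.div_add_mod' k P
  have h2 : k + 1 = P * (k / P + 1) := by rw [mul_comm, Nat.succ_mul]; omega
  rw [h2, Nat.mul_div_cancel_left _ hP]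
  simp

theorem svrg_mul (hP : 0 < P) (t : ℕ → Fin m) (l : ℕ) :
    svrg R f γ P x₀ t (l * P) = svrgOuter R f γ P x₀ t l := by
  simp [svrg, Nat.mul_div_cancel _ hP, svrgInner]

theorem svrg_succ (hP : 0 < P) (t : ℕ → Fin m) (k : ℕ) :
    svrg R f γ P x₀ t (k + 1) = proxStep γ R f (svrg R f γ P x₀ t k)
      (fun i => gradient (f i) (svrgOuter R f γ P x₀ t (k / P))) (t k) := by
  have h0 : k / P * P + k % P = k := Nat.div_add_mod' k P
  have h1 : svrgInner R f γ (svrgOuter R f γ P x₀ t (k / P)) (fun p => t (k / P * P + p))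
      (k % P + 1) = proxStep γ R f (svrg R f γ P x₀ t k)
        (fun i => gradient (f i) (svrgOuter R f γ P x₀ t (k / P))) (t k) := by
    simp only [svrgInner, svrg, proxStep, estimator, h0]
  rw [← h1]
  rcases lt_or_eq_of_le (Nat.succ_le_of_lt (Nat.mod_lt k hP)) with h | h
  · obtain ⟨h2, h3⟩ := succ_div_mod_of_lt hP h
    rw [svrg, h2, h3]
  · obtain ⟨h2, h3⟩ := succ_div_mod_of_eq hP h
    rw [svrg, h2, h3]
    rw [show k % P + 1 = P from h]
    rfl

theorem tendsto_div_mul_atTop (hP : 0 < P) : Tendsto (fun k : ℕ => k / P * P) atTop atTop := by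
  refine tendsto_atTop_mono (fun k => ?_) (tendsto_sub_atTop_nat P)
  have h1 := Nat.div_add_mod' k P
  have h2 := Nat.mod_lt k hP
  omega

set_option maxHeartbeats 800000 in
theorem exists_ae_tendsto_svrg (hm : 0 < m) (hR : ProperConvexLsc R)
    (hf : ∀ i, ConvexOn ℝ Set.univ (f i)) (hd : ∀ i, Differentiable ℝ (f i)) {L : ℝ} (hL0 : 0 < L)
    (hL : ∀ i x y, ‖gradient (f i) x - gradient (f i) y‖ ≤ L * ‖x - y‖)
    (hcont : ∀ i, Continuous (gradient (f i))) (hmin : (argmin (objective R f)).Nonempty)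
    (hP : 0 < P) (hγ0 : 0 < γ) (hγ : γ * L * (P + 1) < 1)
    {Ω : Type*} [MeasurableSpace Ω] {μ : Measure Ω} [IsProbabilityMeasure μ]
    {s : ℕ → Ω → Fin m} (hs : IIDUniform s μ) :
    ∃ xs : Ω → Euc n, Measurable xs ∧ ∀ᵐ ω ∂μ, xs ω ∈ argmin (objective R f) ∧
      Tendsto (fun k => svrg R f γ P x₀ (fun j => s j ω) k) atTop (𝓝 (xs ω)) ∧
      ∀ M : Set (Euc n), PartlySmooth R (xs ω) M → NonDegenerate R (avgFun f) (xs ω) →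
        ∃ K : ℕ, ∀ k ≥ K, svrg R f γ P x₀ (fun j => s j ω) k ∈ M := by
  let x : ℕ → (ℕ → Fin m) → Euc n := fun k t => svrg R f γ P x₀ t k
  let g : ℕ → (ℕ → Fin m) → Fin m → Euc n := fun k t i =>
    gradient (f i) (svrgOuter R f γ P x₀ t (k / P))
  have hx : ∀ k, DependsOn (x k) (Set.Iio k) := dependsOn_svrg
  have hg : ∀ k, DependsOn (g k) (Set.Iio k) := fun k t t' h => by
    have h1 : svrgOuter R f γ P x₀ t (k / P) = svrgOuter R f γ P x₀ t' (k / P) :=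
      dependsOn_svrgOuter_div k h
    simp only [g, h1]
  have hupd : ∀ k (t : ℕ → Fin m) j, ∀ i ∈ Set.Iio k, Function.update t k j i = t i :=
    fun k t j i hi => Function.update_of_ne (ne_of_lt hi) _ _
  have hstep : ∀ k t, x (k + 1) t = proxStep γ R f (x k t) (g k t) (t k) :=
    fun k t => svrg_succ hP t k
  have hgx : ∀ k t, g k t = fun i => gradient (f i) (x (k / P * P) t) := fun k t => by
    simp only [g, x, svrg_mul hP]
  refine exists_ae_tendsto_of_lyapunov hm hR hf hd hcont hmin hγ0 hs hx hstep fun u hu => ?_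
  have hgap0 := gap_nonneg f u
  -- At a snapshot `gap(g) = gap(x)`, so the costs `2γ²` (variance of `b`), `2γ²` (variance of the
  -- table) and `2γ²(P - 1)` (next weight) all fall on `gap(x)`. Positivity is exactly `γ L (P + 1)
  -- < 1`.
  set ε : ℝ := 2 * γ / L - 2 * γ ^ 2 * (P + 1) with hεdef
  have hε : 0 < ε := by
    have h1 : ε = 2 * γ / L * (1 - γ * L * (P + 1)) := by
      simp only [ε]; field_simp
    rw [h1]
    exact mul_pos (by positivity) (by linarith)
  -- The weight counts the inner steps still to be paid for with the current snapshot. It is `0`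
  -- rather than `P` at a snapshot, so no charge is carried across epochs, where the table is
  -- replaced.
  let w : ℕ → ℝ := fun k => if k % P = 0 then 0 else (P : ℝ) - (k % P : ℕ)
  have hw0 : ∀ k, 0 ≤ w k := fun k => by
    have : ((k % P : ℕ) : ℝ) ≤ P := by exact_mod_cast (Nat.mod_lt k hP).le
    simp only [w]
    split_ifs <;> linarith
  have hwP : ∀ k, w k ≤ P := fun k => by
    have : (0 : ℝ) ≤ ((k % P : ℕ) : ℝ) := Nat.cast_nonneg _
    have : (0 : ℝ) ≤ P := Nat.cast_nonneg _
    simp only [w]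
    split_ifs <;> linarith
  refine ⟨fun k t => 2 * γ ^ 2 * (w k * gap f u (g k t)), fun k t =>
    ε * gap f u (fun i => gradient (f i) (x k t)) + residual γ R f u (x k t) (g k t),
      ε, hε, ?_, ?_, ?_, fun k t => le_rfl, ?_, ?_⟩
  · intro k t t' h
    simp only [hg k h]
  · intro k t t' h
    simp only [hg k h, hx k h]
  · intro k t
    have := hgap0 (g k t)
    have := hw0 k
    positivity
  · intro k t
    have h1 : ∀ j, x (k + 1) (Function.update t k j) = proxStep γ R f (x k t) (g k t) j := fun j => by
      rw [hstep, hx k (hupd k t j), hg k (hupd k t j), Function.update_self]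
    have h2 : ∀ j, w (k + 1) * gap f u (g (k + 1) (Function.update t k j)) =
        ((P : ℝ) - 1 - (k % P : ℕ)) * gap f u (g k t) := by
      intro j
      rcases lt_or_eq_of_le (Nat.succ_le_of_lt (Nat.mod_lt k hP)) with h | h
      · obtain ⟨h2, h3⟩ := succ_div_mod_of_lt hP h
        have h4 : g (k + 1) (Function.update t k j) = g k t := by
          rw [← hg k (hupd k t j)]
          simp only [g, h2]
        rw [h4]
        simp only [w, h3, Nat.succ_ne_zero, if_false]
        push_cast
        ring
      · obtain ⟨h2, h3⟩ := succ_div_mod_of_eq hP h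
        have h5 : ((k % P : ℕ) : ℝ) + 1 = P := by exact_mod_cast h
        simp only [w, h3, if_true]
        rw [← h5]
        ring
    have h3 := mean_norm_proxStep_sub_sq_le hm hR hf hd hL0 hL hγ0 hu (x k t) (g k t)
    simp only [h1, h2]
    rw [mean_add, mean_const hm]
    have h4 := hgap0 fun i => gradient (f i) (x k t)
    have hγ2 : 0 ≤ γ ^ 2 := sq_nonneg γ
    -- Inside an epoch the drop of `w` by one pays exactly for `2γ² gap(g)`; only a snapshot step
    -- has to pay out of `gap(x)`.
    by_cases h0 : k % P = 0
    · have h5 : g k t = fun i => gradient (f i) (x k t) := by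
        rw [hgx, Nat.div_mul_cancel (Nat.dvd_of_mod_eq_zero h0)]
      simp only [w, h0, if_true, Nat.cast_zero]
      rw [h5] at h3 ⊢
      simp only [ε]
      linarith
    · simp only [w, h0, if_false]
      have h6 : 0 ≤ γ ^ 2 * P * gap f u fun i => gradient (f i) (x k t) := by positivity
      simp only [ε]
      linarith
  · intro t ht
    have h1 : Tendsto (fun k => gap f u fun i => gradient (f i) (x k t)) atTop (𝓝 0) := by
      refine squeeze_zero (fun k => hgap0 _) (fun k => ?_) (by simpa using ht.const_mul (1 / ε))
      rw [inv_mul_eq_div, le_div_iff₀ hε, mul_comm]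
      linarith [residual_nonneg γ R f u (x k t) (g k t)]
    -- The table holds the gradients at the iterate of index `(k / P) * P`, which tends to infinity,
    -- so its gap is a reindexing of `h1`.
    have h2 : Tendsto (fun k => gap f u (g k t)) atTop (𝓝 0) := by
      simp only [hgx]
      exact h1.comp (tendsto_div_mul_atTop hP)
    refine squeeze_zero (fun k => ?_) (fun k => ?_)
      (by simpa using h2.const_mul (2 * γ ^ 2 * P))
    · have := hgap0 (g k t)
      have := hw0 k
      positivity
    · rw [mul_assoc (2 * γ ^ 2)]
      have := mul_le_mul_of_nonneg_right (hwP k) (hgap0 (g k t))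
      exact mul_le_mul_of_nonneg_left this (by positivity)

end Svrg

end ProxVR

theorem corollary3p4 {n m : ℕ} (hm : 0 < m)
    -- the problem: minimise `R + (1 / m) ∑ f i`
    (R : ProxVR.Euc n → EReal) (hR : ProxVR.ProperConvexLsc R)
    (f : Fin m → ProxVR.Euc n → ℝ)
    (hfconv : ∀ i, ConvexOn ℝ Set.univ (f i))
    (hfC1 : ∀ i, ContDiff ℝ 1 (f i))
    (Lc : Fin m → ℝ≥0) (hLc : ∀ i, LipschitzWith (Lc i) (gradient (f i)))
    (L : ℝ≥0) (hL : L = Finset.univ.sup Lc)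
    (hmin : (ProxVR.argmin (ProxVR.objective R f)).Nonempty)
    -- initial point and random samples
    (x₀ : ProxVR.Euc n)
    {Ω : Type*} [MeasurableSpace Ω] (μ : Measure Ω) [IsProbabilityMeasure μ]
    (s : ℕ → Ω → Fin m) (hs : ProxVR.IIDUniform s μ) :
    -- SAGA
    (∀ γ : ℝ, 0 < L → γ = 1 / (3 * (L : ℝ)) →
      ∃ xs : Ω → ProxVR.Euc n, Measurable xs ∧ ∀ᵐ ω ∂μ,
        xs ω ∈ ProxVR.argmin (ProxVR.objective R f) ∧
        Tendsto (fun k => ProxVR.saga R f γ x₀ (fun j => s j ω) k) atTop (𝓝 (xs ω)) ∧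
        ∀ M : Set (ProxVR.Euc n), ProxVR.PartlySmooth R (xs ω) M →
          ProxVR.NonDegenerate R (ProxVR.avgFun f) (xs ω) →
          ∃ K : ℕ, ∀ k ≥ K, ProxVR.saga R f γ x₀ (fun j => s j ω) k ∈ M) ∧
    -- Prox-SVRG with Option I
    (∀ (P : ℕ) (γ : ℝ), 0 < P → 0 < γ →
      (4 * (L : ℝ) * (P + 2) * γ ≤ 1 ∨
        ((∃ αR > 0, ProxVR.StronglyConvexFun αR R) ∧
          (∃ αF > 0, StrongConvexOn Set.univ αF (ProxVR.avgFun f)) ∧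
          4 * (L : ℝ) * γ * (P + 1) < 1)) →
      ∃ xs : Ω → ProxVR.Euc n, Measurable xs ∧ ∀ᵐ ω ∂μ,
        xs ω ∈ ProxVR.argmin (ProxVR.objective R f) ∧
        Tendsto (fun k => ProxVR.svrg R f γ P x₀ (fun j => s j ω) k) atTop (𝓝 (xs ω)) ∧
        ∀ M : Set (ProxVR.Euc n), ProxVR.PartlySmooth R (xs ω) M →
          ProxVR.NonDegenerate R (ProxVR.avgFun f) (xs ω) →
          ∃ K : ℕ, ∀ k ≥ K, ProxVR.svrg R f γ P x₀ (fun j => s j ω) k ∈ M) := by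
  have hd : ∀ i, Differentiable ℝ (f i) := fun i => (hfC1 i).differentiable one_ne_zero
  have hcont : ∀ i, Continuous (gradient (f i)) := fun i => (hLc i).continuous
  have hLip : ∀ i x y, ‖gradient (f i) x - gradient (f i) y‖ ≤ (L : ℝ) * ‖x - y‖ := by
    intro i x y
    have h1 : (Lc i : ℝ) ≤ L := by
      rw [hL]
      exact_mod_cast Finset.le_sup (Finset.mem_univ i)
    have h2 := (hLc i).dist_le_mul x y
    rw [dist_eq_norm, dist_eq_norm] at h2
    exact h2.trans (mul_le_mul_of_nonneg_right h1 (norm_nonneg _))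
  refine ⟨fun γ hL0 hγ => ProxVR.exists_ae_tendsto_saga hm hR hfconv hd (by exact_mod_cast hL0) hLip
    hcont hmin hγ hs, fun P γ hP hγ0 hstep => ?_⟩
  have hL0 : (0 : ℝ) ≤ L := L.2
  have hP1 : (0 : ℝ) < P + 1 := by positivity
  have hbound : 4 * (L : ℝ) * γ * (P + 1) < 1 := by
    rcases hstep with h | ⟨-, -, h⟩
    · rcases hL0.eq_or_lt with h0 | h0
      · rw [← h0]; norm_num
      · have : 0 < (L : ℝ) * γ := by positivity
        linarith
    · exact h
  -- `L` may be `0`, while cocoercivity needs a positive constant. Any larger Lipschitz constant is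
  -- admissible, and the second entry of the maximum gives `γ L (P + 1) = 1 / 2`.
  refine ProxVR.exists_ae_tendsto_svrg (L := max (L : ℝ) (1 / (2 * γ * (P + 1)))) hm hR hfconv hd
    (lt_max_of_lt_right (by positivity)) (fun i x y => (hLip i x y).trans
      (mul_le_mul_of_nonneg_right (le_max_left _ _) (norm_nonneg _))) hcont hmin hP hγ0 ?_ hs
  rcases max_cases (L : ℝ) (1 / (2 * γ * (P + 1))) with ⟨h, -⟩ | ⟨h, -⟩
  · rw [h]
    have : 0 ≤ (L : ℝ) * γ * (P + 1) := by positivity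
    linarith
  · rw [h]
    field_simp
    norm_num
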